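/- Let $n\ge 1$ and let $\mathfrak{g}=\mathfrak{sl}(n+1)\ltimes\mathbb{C}^{n+1}$ be the semidirect sum of $\mathfrak{sl}(n+1)=\mathfrak{sl}(n+1,\mathbb{C})$ with its standard representation ($\mathbb{C}^{n+1}$ being an abelian ideal). Let $A_{i,j}$ be the matrix units, $H_i=A_{i,i}-A_{i+1,i+1}$ for $1\le i\le n$, $E_{p,q}=A_{p,q+1}$ and $F_{p,q}=A_{q+1,p}$ for $1\le p\le q\le n$, and let $P_1,\dots,P_{n+1}$ be the standard basis of $\mathbb{C}^{n+1}$. Let $\omega_1,\dots,\omega_n$ be the fundamental weights and $\omega_0=\omega_{n+1}=0$; integral weights are written $\mu=\sum_i\mu_i\omega_i$ with $\mu_i\in\mathbb{Z}$. A highest weight vector of weight $\mu$ in a $\mathfrak{g}$-module is a vector $v\ne 0$ with $E_{p,q}v=0$ for all $p\le q$ and $H_iv=\mu_iv$ for all $i$. For an integral weight $\mu$ put $\mu_{k,s}=-\sum_{i=k}^{s}(\mu_i+1)$. For $1\le i\le n+1$ put $\tilde P_a=\bigl(\prod_{k=1}^{a-1}\mu_{k,i-1}\bigr)P_a$ for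 $1\le a\le i$ and $\tilde F_{p,q}=\bigl(\prod_{k=p+1}^{q}\mu_{k,i-1}\bigr)F_{p,q}$ for $1\le p\le q\le i-1$, and define elements of the universal enveloping algebra recursively by $Q_i=1$ and $Q_a=\sum_{l=a}^{i-1}Q_{l+1}\tilde F_{a,l}$ for $1\le a\le i-1$. For a vector $v_\mu$ of weight $\mu$ let $$\varphi_i(v_\mu)=\tilde P_i v_\mu+\sum_{a=1}^{i-1}Q_a\tilde P_a v_\mu ,$$ which is a vector of weight $\mu+\omega_i-\omega_{i-1}$; in iterates of the $\varphi_i$ the weight is updated at each step. Let $V$ be a finite-dimensional $\mathfrak{g}$-module generated by a highest weight vector $v$ of weight $\mu_0$, that is, $V=\mathcal{U}(\mathfrak{g})v$. Define recursively $J_1$ as the least positive integer with $\varphi_1^{J_1}(v)=0$ and, for $1\le l\le n$ and all integers $i_1,\dots,i_l$ with $0\le i_1<J_1$ and $0\le i_h<J_h(i_1,\dots,i_{h-1})$ for $2\le h\le l$, $J_{l+1}(i_1,\dots,i_l)$ as the least positive integer with $$\varphi_{l+1}^{J_{l+1}(i_1,\dots,i_l)}\bigl(\varphi_l^{i_l}(\cdots\varphi_1^{i_1}(v)\cdots)\bigr)=0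 .$$ Let $\mathcal{J}(V)$ consist of the weight $\mu_0$ and of all the numbers $J_1$ and $J_{l+1}(i_1,\dots,i_l)$, each together with its label $(i_1,\dots,i_l)$. **Theorem.** Let $V$ and $W$ be finite-dimensional $\mathfrak{g}$-modules generated by highest weight vectors $v$ of weight $\mu_0$ and $w$ of weight $\nu_0$ respectively. If $V$ and $W$ are isomorphic as $\mathfrak{g}$-modules, then $\mathcal{J}(V)$, computed from $v$, and $\mathcal{J}(W)$, computed from $w$, coincide: $\mu_0=\nu_0$, and the two families of numbers have the same index tuples and the same values. (In particular $\mathcal{J}(V)$ does not depend on the choice of the highest weight generator.) -/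

import Mathlib

namespace CyclicSL

noncomputable section

/-! ### The Lie algebra `sl(n+1) ⋉ ℂ^{n+1}`

Rows, columns and vector entries are indexed by `Fin (n+1)`, starting at `0`; so the index `i` here
is the index `i + 1` of the usual numbering `1, …, n+1`. Simple roots and fundamental weights are
indexed by `Fin n`, in the same way. -/

/-- `sl(n+1)` over `ℂ`. -/
abbrev SL (n : ℕ) : Type := LieAlgebra.SpecialLinear.sl (Fin (n + 1)) ℂ

/-- The vector space `ℂ^{n+1}`, which will carry the zero bracket. -/
def Std (n : ℕ) : Type := Fin (n + 1) → ℂ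

instance (n : ℕ) : AddCommGroup (Std n) := inferInstanceAs (AddCommGroup (Fin (n + 1) → ℂ))

instance (n : ℕ) : Module ℂ (Std n) := inferInstanceAs (Module ℂ (Fin (n + 1) → ℂ))

/-- `ℂ^{n+1}` as an abelian Lie algebra. -/
instance (n : ℕ) : LieRing (Std n) where
  bracket _ _ := 0
  add_lie _ _ _ := (add_zero _).symm
  lie_add _ _ _ := (add_zero _).symm
  lie_self _ := rfl
  leibniz_lie _ _ _ := (add_zero _).symm

instance (n : ℕ) : LieAlgebra ℂ (Std n) where
  lie_smul _ _ _ := (smul_zero _).symm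

theorem std_lie {n : ℕ} (x y : Std n) : ⁅x, y⁆ = 0 := rfl

/-- Multiplication of column vectors by a matrix. -/
def mulStd {n : ℕ} (A : Matrix (Fin (n + 1)) (Fin (n + 1)) ℂ) : Std n →ₗ[ℂ] Std n where
  toFun x := A.mulVec x
  map_add' x y := Matrix.mulVec_add A x y
  map_smul' c x := Matrix.mulVec_smul A c x

/-- The standard representation `X ↦ (x ↦ X x)` of `sl(n+1)` on `ℂ^{n+1}`; every linear
endomorphism of an abelian Lie algebra is a derivation. -/
def stdAction (n : ℕ) : SL n →ₗ⁅ℂ⁆ LieDerivation ℂ (Std n) (Std n) where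
  toFun X :=
    { toLinearMap := mulStd X.val
      leibniz' := fun a b => by
        rw [std_lie, std_lie, std_lie, map_zero, sub_zero] }
  map_add' X Y := by
    ext x : 1
    exact Matrix.add_mulVec X.val Y.val (x : Fin (n + 1) → ℂ)
  map_smul' c X := by
    ext x : 1
    exact Matrix.smul_mulVec c X.val (x : Fin (n + 1) → ℂ)
  map_lie' := by
    intro X Y
    have key : ∀ (A B : Matrix (Fin (n + 1)) (Fin (n + 1)) ℂ) (x : Fin (n + 1) → ℂ),
        (A * B - B * A).mulVec x = A.mulVec (B.mulVec x) - B.mulVec (A.mulVec x) := by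
      intro A B x
      rw [Matrix.sub_mulVec, Matrix.mulVec_mulVec, Matrix.mulVec_mulVec]
    ext x : 1
    rw [LieDerivation.commutator_apply]
    exact key X.val Y.val x

/-- The semidirect sum `sl(n+1) ⋉ ℂ^{n+1}` with respect to the standard representation. -/
abbrev G (n : ℕ) : Type := LieAlgebra.SemiDirectSum (Std n) (SL n) (stdAction n)

/-- The universal enveloping algebra of `sl(n+1) ⋉ ℂ^{n+1}`. -/
abbrev U (n : ℕ) : Type := UniversalEnvelopingAlgebra ℂ (G n)

/-- An element of `sl(n+1)` as an element of `sl(n+1) ⋉ ℂ^{n+1}`. -/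
def ofSL {n : ℕ} (X : SL n) : G n := LieAlgebra.SemiDirectSum.inr (stdAction n) X

/-- An element of `ℂ^{n+1}` as an element of `sl(n+1) ⋉ ℂ^{n+1}`. -/
def ofStd {n : ℕ} (x : Std n) : G n := LieAlgebra.SemiDirectSum.inl (stdAction n) x

/-- The matrix unit with entry `1` in row `i` and column `j`, for `i ≠ j`. For `i < j` these are
the root vectors `E_{i, j-1}`, for `i > j` the root vectors `F_{j, i-1}`. -/
def rootVector {n : ℕ} (i j : Fin (n + 1)) (h : i ≠ j) : G n :=
  ofSL (LieAlgebra.SpecialLinear.single i j h 1)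

/-- The simple coroot `H_i`: diagonal, with `1` and `-1` in two consecutive places. -/
def coroot {n : ℕ} (i : Fin n) : G n :=
  ofSL (LieAlgebra.SpecialLinear.singleSubSingle i.castSucc i.succ 1)

/-- The standard basis vector `P_i` of `ℂ^{n+1}`. -/
def P {n : ℕ} (i : Fin (n + 1)) : G n :=
  ofStd (Pi.single i 1 : Fin (n + 1) → ℂ)

/-! ### Weights, highest weight vectors, generators -/

/-- An integral weight `∑ μ_i ω_i`, given by its coordinates in the fundamental weights, that is,
by its values on the simple coroots. -/
abbrev Weight (n : ℕ) : Type := Fin n → ℤ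

/-- `v` is a highest weight vector of weight `μ` for `sl(n+1)`. -/
structure IsHighestWeightVector {n : ℕ} {V : Type*} [AddCommGroup V] [Module ℂ V]
    [LieRingModule (G n) V] (μ : Weight n) (v : V) : Prop where
  ne_zero : v ≠ 0
  raising : ∀ (i j : Fin (n + 1)) (h : i < j), ⁅rootVector i j h.ne, v⁆ = 0
  weight : ∀ i : Fin n, ⁅(coroot i : G n), v⁆ = (μ i : ℂ) • v

section Module

variable {n : ℕ} {V : Type*} [AddCommGroup V] [Module ℂ V] [LieRingModule (G n) V]
  [LieModule ℂ (G n) V]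

/-- The action of the enveloping algebra on a module. -/
def act (u : U n) (v : V) : V :=
  UniversalEnvelopingAlgebra.lift ℂ (LieModule.toEnd ℂ (G n) V) u v

variable (n) in
/-- `v` generates the module `V`, i.e. `V = U(sl(n+1) ⋉ ℂ^{n+1}) v`. -/
def Generates (v : V) : Prop := ∀ x : V, ∃ u : U n, act u v = x

end Module

/-! ### The operators `φ_i` -/

/-- `-∑_{a ≤ c < b} (μ_c + 1)`. In the numbering from `1`, the number
`μ_{k,s} = -∑_{i=k}^{s} (μ_i + 1)` is `shiftedSum μ (k-1) s`. -/
def shiftedSum {n : ℕ} (μ : Weight n) (a b : Fin (n + 1)) : ℤ :=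
  -∑ c : Fin n with a ≤ c.castSucc ∧ c.castSucc < b, (μ c + 1)

/-- `(∏_{c < a} μ_{c,t}) P_a`, in the enveloping algebra. -/
def scaledP {n : ℕ} (μ : Weight n) (t a : Fin (n + 1)) : U n :=
  ((∏ c ∈ Finset.Iio a, shiftedSum μ c t : ℤ) : ℂ) • UniversalEnvelopingAlgebra.ι ℂ (P a)

/-- `(∏_{a < c < b} μ_{c,t}) F`, where `F` is the matrix unit in row `b` and column `a`, for
`a < b`. -/
def scaledF {n : ℕ} (μ : Weight n) (t a b : Fin (n + 1)) (h : a < b) : U n :=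
  ((∏ c ∈ Finset.Ioo a b, shiftedSum μ c t : ℤ) : ℂ) •
    UniversalEnvelopingAlgebra.ι ℂ (rootVector b a h.ne')

/-- The elements `Q_a`, for `a ≤ t`, with `Q_t = 1` and `Q_a = ∑_{a < b ≤ t} Q_b F_{a,b}`, where
`F_{a,b}` is the scaled root vector above. -/
def Q {n : ℕ} (μ : Weight n) (t a : Fin (n + 1)) : U n :=
  if a = t then 1
  else ∑ b ∈ (Finset.Ioc a t).attach,
    Q μ t b.1 * scaledF μ t a b.1 (Finset.mem_Ioc.mp b.2).1
termination_by n + 1 - a.val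
decreasing_by
  have := Fin.lt_def.mp (Finset.mem_Ioc.mp b.2).1
  have := b.1.isLt
  omega

/-- The element of the enveloping algebra which defines `φ_i` on vectors of weight `μ`. -/
def phiElt {n : ℕ} (μ : Weight n) (i : Fin (n + 1)) : U n :=
  scaledP μ i i + ∑ a ∈ Finset.Iio i, Q μ i a * scaledP μ i a

/-- The weight `μ + ω_i - ω_{i-1}` in the numbering from `1`, with `ω_0 = ω_{n+1} = 0`. -/
def shiftWeight {n : ℕ} (μ : Weight n) (i : Fin (n + 1)) : Weight n := fun c =>
  μ c + (if c.castSucc = i then 1 else 0) - (if c.succ = i then 1 else 0)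

section Invariants

variable {n : ℕ} {V : Type*} [AddCommGroup V] [Module ℂ V] [LieRingModule (G n) V]
  [LieModule ℂ (G n) V]

/-- `φ_i`, acting on a vector together with its weight: `φ_i(v_μ)` has weight
`μ + ω_i - ω_{i-1}`, and the coefficients in `φ_i` depend on the weight of its argument. -/
def phi (i : Fin (n + 1)) (x : Weight n × V) : Weight n × V :=
  (shiftWeight x.1 i, act (phiElt x.1 i) x.2)

/-- `φ_l^{k_l}(⋯ (φ_1^{k_1}(v)) ⋯)`, with its weight, for a vector `v` with its weight. -/
def iterPhi (x : Weight n × V) : (l : ℕ) → l ≤ n + 1 → (Fin l → ℕ) → Weight n × V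
  | 0, _, _ => x
  | l + 1, hl, k =>
    (phi ⟨l, hl⟩)^[k (Fin.last l)] (iterPhi x l (Nat.le_of_succ_le hl) (Fin.init k))

/-- The number `J_{l+1}(k_1, …, k_l)`: the least positive `m` such that
`φ_{l+1}^m(φ_l^{k_l}(⋯ (φ_1^{k_1}(v)) ⋯)) = 0`. (If `n ≥ 1`, the module is finite-dimensional and
`v` is a weight vector, such an `m` exists: the nonzero vectors among these have distinct weights.
The value `0` would mean that there is no such `m`.) -/
def J (x : Weight n × V) (l : Fin (n + 1)) (k : Fin l.val → ℕ) : ℕ :=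
  sInf {m : ℕ | 0 < m ∧ ((phi l)^[m] (iterPhi x l.val l.isLt.le k)).2 = 0}

/-- The condition `k_h < J_h(k_1, …, k_{h-1})` for `1 ≤ h ≤ l`. -/
def Admissible (x : Weight n × V) (l : Fin (n + 1)) (k : Fin l.val → ℕ) : Prop :=
  ∀ h : Fin l.val, k h < J x (h.castLE l.isLt.le) (Fin.take h.val h.isLt.le k)

/-- The invariant set of a module, computed from the generator `v` of weight `μ`: the weight `μ`,
and the numbers `J_{l+1}(k_1, …, k_l)`, for `0 ≤ l ≤ n` and all admissible `(k_1, …, k_l)`, each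
with its label `(k_1, …, k_l)`. -/
def invariantSet (μ : Weight n) (v : V) :
    Weight n × Set ((l : Fin (n + 1)) × (Fin l.val → ℕ) × ℕ) :=
  (μ, {p | ∃ (l : Fin (n + 1)) (k : Fin l.val → ℕ),
    Admissible (μ, v) l k ∧ p = ⟨l, k, J (μ, v) l k⟩})

end Invariants

end

end CyclicSL

/-! After transport along the isomorphism, `v` and `w` become two highest weight generators of one
module. The vectors tested in the definition of the invariants are `u v` with `u` in the enveloping
algebra depending only on the weight and the label. So it suffices that the two generators have the
same weight and the same annihilator; the `φ_i` themselves need no analysis.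

Both facts come from normalised operators `psi`, which take highest weight vectors of weight `χ` to
ones of weight `χ + ε_b`. A Casimir argument (`eq_zero_of_mem_highest_of_mem_lower`) shows that a
highest weight vector is determined modulo `lower`. Two consequences: the `psi` commute up to
nonzero scalars (`psi_psi`), because the `p` commute; and the highest weight vectors in the
submodule generated by `v` are spanned by words in `psi` applied to `v` (`mem_span_psiList`). As
`ε_0 + ⋯ + ε_n = 0` on `sl(n+1)`, words with the same weight shift differ, up to order, by copies of
the full word containing each index once. Hence the highest weight vectors of one weight form a
cyclic module over `ℂ[A]`, with `A` the full word (`exists_aeval`).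

If the weights of two generators differed, going from `v` to `w` and back would give `v = A q(A) v`,
impossible since `A` is nilpotent on `v`. If the weights agree, let `(0, y)` lie in the submodule of
`V × V` generated by `(v, w)`. Were `y` nonzero, there would be a nonzero highest weight vector with
first component zero. Its components are `q(A) v'` and `q(A) r(A) v'` for one vector `v'`; the first
vanishes, and polynomials in `A` commute, so the second vanishes too. -/

namespace CyclicSL

noncomputable section

/-! ### Commutation relations, comparison of weights, Casimir eigenvalues -/

/-- Operators `e i j` and `p k` on a vector space satisfying the commutation relations of the
traceless parts of the matrix units and of the standard basis vectors in
`sl(n+1) ⋉ ℂ^{n+1}`. -/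
structure OperatorSystem (n : ℕ) (V : Type*) [AddCommGroup V] [Module ℂ V] where
  /-- the traceless part of a matrix unit -/
  e : Fin (n + 1) → Fin (n + 1) → Module.End ℂ V
  /-- a standard basis vector -/
  p : Fin (n + 1) → Module.End ℂ V
  e_e : ∀ i j k l x, e i j (e k l x) =
    e k l (e i j x) + (if j = k then e i l x else 0) - (if l = i then e k j x else 0)
  e_p : ∀ i j k x, e i j (p k x) =
    p k (e i j x) + (if j = k then p i x else 0) -
      (if i = j then ((n : ℂ) + 1)⁻¹ • p k x else 0)
  p_p : ∀ i j x, p i (p j x) = p j (p i x)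

/-- The weight `χ + ε_a - ε_b`. -/
def addRoot {n : ℕ} (χ : Fin (n + 1) → ℂ) (a b : Fin (n + 1)) : Fin (n + 1) → ℂ := fun i =>
  χ i + (if i = a then 1 else 0) - (if i = b then 1 else 0)

/-- `χ' - χ` pairs positively with every regular dominant weight. -/
def Above {n : ℕ} (χ' χ : Fin (n + 1) → ℂ) : Prop :=
  ∑ i, (χ' i - χ i) = 0 ∧ ∀ θ : Fin (n + 1) → ℝ, StrictAnti θ →
    ∃ r : ℝ, 0 < r ∧ ∑ i, (χ' i - χ i) * θ i = r

theorem above_addRoot {n : ℕ} (χ : Fin (n + 1) → ℂ) {a b : Fin (n + 1)} (h : a < b) :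
    Above (addRoot χ a b) χ := by
  constructor
  · simp [addRoot, add_sub_assoc]
  · intro θ hθ
    refine ⟨θ a - θ b, sub_pos.mpr (hθ h), ?_⟩
    simp [addRoot, add_sub_assoc, sub_mul]

theorem Above.trans {n : ℕ} {χ₁ χ₂ χ₃ : Fin (n + 1) → ℂ} (h₁ : Above χ₁ χ₂) (h₂ : Above χ₂ χ₃) :
    Above χ₁ χ₃ := by
  have key : ∀ θ : Fin (n + 1) → ℂ, ∑ i, (χ₁ i - χ₃ i) * θ i =
      ∑ i, (χ₁ i - χ₂ i) * θ i + ∑ i, (χ₂ i - χ₃ i) * θ i := by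
    intro θ
    rw [← Finset.sum_add_distrib]
    exact Finset.sum_congr rfl fun i _ => by ring
  constructor
  · have := key 1
    simp only [Pi.one_apply, mul_one] at this
    rw [this, h₁.1, h₂.1, add_zero]
  · intro θ hθ
    obtain ⟨r, hr, hr'⟩ := h₁.2 θ hθ
    obtain ⟨s, hs, hs'⟩ := h₂.2 θ hθ
    refine ⟨r + s, add_pos hr hs, ?_⟩
    rw [key fun i => (θ i : ℂ), hr', hs', Complex.ofReal_add]

/-- The eigenvalue of the Casimir operator on highest weight vectors of weight `χ`. -/
def casimirValue {n : ℕ} (χ : Fin (n + 1) → ℂ) : ℂ :=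
  ∑ i, ∑ j, if i = j then χ i ^ 2 else if i < j then χ i - χ j else 0

theorem casimirValue_eq {n : ℕ} (χ : Fin (n + 1) → ℂ) :
    casimirValue χ = ∑ i, (χ i ^ 2 + χ i * (n - 2 * (i : ℕ))) := by
  have h1 : ∀ i j : Fin (n + 1), (if i = j then χ i ^ 2 else if i < j then χ i - χ j else 0) =
      (if i = j then χ i ^ 2 else 0) + (if i < j then χ i else 0) - (if i < j then χ j else 0) := by
    intro i j
    rcases lt_trichotomy i j with h | h | h
    · simp [h, h.ne]
    · simp [h]
    · simp [h.ne', h.not_gt]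
  have h2 : ∑ i : Fin (n + 1), ∑ j : Fin (n + 1), (if i < j then χ j else 0) =
      ∑ i : Fin (n + 1), (i : ℕ) * χ i := by
    rw [Finset.sum_comm]
    refine Finset.sum_congr rfl fun j _ => ?_
    rw [← Finset.sum_filter, Finset.sum_const, nsmul_eq_mul]
    congr 2
    have : Finset.univ.filter (fun i => i < j) = Finset.Iio j := by ext; simp
    rw [this, Fin.card_Iio]
  have h3 : ∑ i : Fin (n + 1), ∑ j : Fin (n + 1), (if i < j then χ i else 0) =
      ∑ i : Fin (n + 1), (n - (i : ℕ)) * χ i := by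
    refine Finset.sum_congr rfl fun i _ => ?_
    rw [← Finset.sum_filter, Finset.sum_const, nsmul_eq_mul]
    congr 1
    have : Finset.univ.filter (fun j => i < j) = Finset.Ioi i := by ext; simp
    rw [this, Fin.card_Ioi]
    have := i.isLt
    rw [show n + 1 - 1 - (i : ℕ) = n - (i : ℕ) by omega, Nat.cast_sub (by omega)]
  simp only [casimirValue, h1, Finset.sum_add_distrib, Finset.sum_sub_distrib, h2, h3]
  rw [← Finset.sum_add_distrib, ← Finset.sum_add_distrib, ← Finset.sum_sub_distrib]
  refine Finset.sum_congr rfl fun i _ => ?_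
  simp
  ring

/-- The differences `χ_a - χ_b`, `a < b`, are natural numbers. -/
def Dominant {n : ℕ} (χ : Fin (n + 1) → ℂ) : Prop := ∀ a b, a < b → ∃ m : ℕ, χ a - χ b = m

/-- The difference of the two values is the pairing of `χ' - χ` with `χ' + χ + 2ρ`, which is
strictly decreasing when both weights are dominant. -/
theorem Above.casimirValue_ne {n : ℕ} {χ' χ : Fin (n + 1) → ℂ} (h : Above χ' χ)
    (h' : Dominant χ') (hχ : Dominant χ) : casimirValue χ' ≠ casimirValue χ := by
  have real : ∀ {χ : Fin (n + 1) → ℂ}, Dominant χ → ∀ i, ((χ i - χ 0).re : ℂ) = χ i - χ 0 := by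
    intro χ hχ i
    rcases eq_or_ne i 0 with rfl | hi
    · simp
    · obtain ⟨m, hm⟩ := hχ 0 i (Fin.pos_iff_ne_zero.mpr hi)
      rw [show χ i - χ 0 = -(m : ℂ) by rw [← hm]; ring]
      simp
  have anti : ∀ {χ : Fin (n + 1) → ℂ}, Dominant χ → Antitone fun i => (χ i - χ 0).re := by
    intro χ hχ
    refine antitone_iff_forall_lt.mpr fun a b hab => ?_
    obtain ⟨m, hm⟩ := hχ a b hab
    have := congrArg Complex.re hm
    simp only [Complex.sub_re, Complex.natCast_re] at this ⊢
    have hm0 : (0 : ℝ) ≤ m := Nat.cast_nonneg m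
    linarith
  -- This is `χ' + χ + 2ρ`, with `χ' 0 + χ 0` subtracted to make it real; the subtraction is
  -- harmless because the coordinates of `χ' - χ` sum to zero.
  let θ : Fin (n + 1) → ℝ := fun i => (χ' i - χ' 0).re + (χ i - χ 0).re + (n - 2 * (i : ℕ))
  have hθ : StrictAnti θ := by
    intro a b hab
    have h1 := anti h' hab.le
    have h2 := anti hχ hab.le
    have h3 : ((a : ℕ) : ℝ) < ((b : ℕ) : ℝ) := by exact_mod_cast hab
    simp only [θ] at *
    linarith
  obtain ⟨r, hr, hr'⟩ := h.2 θ hθ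
  intro heq
  have : casimirValue χ' - casimirValue χ = ∑ i, (χ' i - χ i) * θ i +
      (χ' 0 + χ 0) * ∑ i, (χ' i - χ i) := by
    rw [casimirValue_eq, casimirValue_eq, ← Finset.sum_sub_distrib, Finset.mul_sum,
      ← Finset.sum_add_distrib]
    refine Finset.sum_congr rfl fun i _ => ?_
    simp only [θ, Complex.ofReal_add, real h', real hχ]
    push_cast
    ring
  rw [heq, sub_self, h.1, mul_zero, add_zero, hr'] at this
  exact hr.ne (by exact_mod_cast this)

/-! ### Highest weight vectors and the Casimir operator -/

namespace OperatorSystem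

variable {n : ℕ} {V : Type*} [AddCommGroup V] [Module ℂ V] (D : OperatorSystem n V)

/-- The weight space of weight `χ`. -/
def weightSpace (χ : Fin (n + 1) → ℂ) : Submodule ℂ V :=
  ⨅ i, Module.End.eigenspace (D.e i i) (χ i)

theorem mem_weightSpace {χ : Fin (n + 1) → ℂ} {x : V} :
    x ∈ D.weightSpace χ ↔ ∀ i, D.e i i x = χ i • x := by
  simp [weightSpace]

/-- The space of highest weight vectors of weight `χ`, with `0`. -/
def highest (χ : Fin (n + 1) → ℂ) : Submodule ℂ V :=
  D.weightSpace χ ⊓ ⨅ a, ⨅ b, ⨅ _ : a < b, LinearMap.ker (D.e a b)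

theorem mem_highest {χ : Fin (n + 1) → ℂ} {x : V} :
    x ∈ D.highest χ ↔ x ∈ D.weightSpace χ ∧ ∀ a b, a < b → D.e a b x = 0 := by
  simp [highest]

theorem e_mem_weightSpace {χ : Fin (n + 1) → ℂ} {x : V} (hx : x ∈ D.weightSpace χ)
    (a b : Fin (n + 1)) : D.e a b x ∈ D.weightSpace (addRoot χ a b) := by
  rw [mem_weightSpace] at hx ⊢
  intro i
  rw [D.e_e, hx i, map_smul]
  simp only [addRoot, sub_smul, add_smul, ite_smul, one_smul, zero_smul, @eq_comm _ b i]
  split_ifs <;> simp_all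

theorem e_e_apply_of_mem_weightSpace {χ : Fin (n + 1) → ℂ} {x : V} (hx : x ∈ D.weightSpace χ)
    (a b : Fin (n + 1)) : D.e a b (D.e b a x) = D.e b a (D.e a b x) + (χ a - χ b) • x := by
  rw [mem_weightSpace] at hx
  rw [D.e_e, if_pos rfl, if_pos rfl, hx, hx, sub_smul, add_sub_assoc]

attribute [local instance] LieRing.ofAssociativeRing

theorem dominant_of_mem_highest [FiniteDimensional ℂ V] {χ : Fin (n + 1) → ℂ} {x : V}
    (hx : x ∈ D.highest χ) (h0 : x ≠ 0) : Dominant χ := by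
  intro a b hab
  rw [mem_highest] at hx
  have hx' := D.mem_weightSpace.mp hx.1
  -- An `IsSl2Triple` requires a nonzero Cartan element; if it acts by zero, then `χ a = χ b`.
  by_cases hz : D.e a a - D.e b b = 0
  · refine ⟨0, ?_⟩
    have := LinearMap.congr_fun hz x
    rw [LinearMap.sub_apply, hx', hx', ← sub_smul, LinearMap.zero_apply] at this
    simpa using (smul_eq_zero.mp this).resolve_right h0
  · have t : IsSl2Triple (D.e a a - D.e b b) (D.e a b) (D.e b a) := by
      refine ⟨hz, ?_, ?_, ?_⟩
      · ext y
        simp only [Ring.lie_def, LinearMap.sub_apply, Module.End.mul_apply]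
        rw [D.e_e a b b a]
        simp only [if_true]
        abel
      · rw [two_nsmul]
        ext y
        simp only [Ring.lie_def, LinearMap.sub_apply, Module.End.mul_apply, map_sub]
        rw [D.e_e a a a b, D.e_e b b a b]
        simp only [if_true, if_neg hab.ne', LinearMap.add_apply]
        abel
      · rw [two_nsmul]
        ext y
        simp only [Ring.lie_def, LinearMap.sub_apply, Module.End.mul_apply, map_sub]
        rw [D.e_e a a b a, D.e_e b b b a]
        simp only [if_true, if_neg hab.ne, LinearMap.neg_apply, LinearMap.add_apply]
        abel
    have P : t.HasPrimitiveVectorWith x (χ a - χ b) := by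
      refine ⟨h0, ?_, ?_⟩
      · change (D.e a a - D.e b b) x = _
        rw [LinearMap.sub_apply, hx', hx', ← sub_smul]
      · exact hx.2 a b hab
    exact P.exists_nat

/-- Every weight vector in a stable subspace can be raised to a highest weight vector. -/
theorem exists_mem_highest [FiniteDimensional ℂ V] {K : Submodule ℂ V}
    (hK : ∀ a b, ∀ x ∈ K, D.e a b x ∈ K) {χ : Fin (n + 1) → ℂ} {y : V} (hy : y ∈ D.weightSpace χ)
    (hyK : y ∈ K) (hy0 : y ≠ 0) :
    ∃ χ', (χ' = χ ∨ Above χ' χ) ∧ ∃ x ∈ D.highest χ', x ∈ K ∧ x ≠ 0 := by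
  -- With this sign, `e a b` for `a < b` raises the eigenvalue of `H` by `b - a`. There are finitely
  -- many eigenvalues, so a reachable weight of maximal real height exists, and its vectors are
  -- killed by all raising operators.
  let H : Module.End ℂ V := ∑ i : Fin (n + 1), (-((i : ℕ) : ℂ)) • D.e i i
  let ht : (Fin (n + 1) → ℂ) → ℂ := fun χ => ∑ i : Fin (n + 1), -((i : ℕ) : ℂ) * χ i
  let R : Set (Fin (n + 1) → ℂ) :=
    {χ' | (χ' = χ ∨ Above χ' χ) ∧ ∃ x ∈ D.weightSpace χ', x ∈ K ∧ x ≠ 0}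
  have hfin : ((fun χ' => (ht χ').re) '' R).Finite := by
    refine ((Module.End.finite_hasEigenvalue H).image Complex.re).subset ?_
    rintro _ ⟨χ', ⟨-, x, hx, -, hx0⟩, rfl⟩
    refine ⟨ht χ', ?_, rfl⟩
    refine Module.End.hasEigenvalue_of_hasEigenvector (x := x) ⟨?_, hx0⟩
    rw [Module.End.mem_eigenspace_iff]
    simp only [H, ht, LinearMap.sum_apply, LinearMap.smul_apply, D.mem_weightSpace.mp hx,
      smul_smul, Finset.sum_smul]
  obtain ⟨_, ⟨χ', ⟨hχ', x, hx, hxK, hx0⟩, rfl⟩, hmax⟩ := Set.exists_max_image _ id hfin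
    ⟨_, χ, ⟨Or.inl rfl, y, hy, hyK, hy0⟩, rfl⟩
  refine ⟨χ', hχ', x, D.mem_highest.mpr ⟨hx, fun a b hab => ?_⟩, hxK, hx0⟩
  by_contra hne
  have hab' := above_addRoot χ' hab
  have := hmax _ ⟨addRoot χ' a b, ⟨Or.inr ?_, _, D.e_mem_weightSpace hx a b, hK _ _ _ hxK, hne⟩,
    rfl⟩
  · obtain ⟨r, hr, hr'⟩ := hab'.2 (fun i => -((i : ℕ) : ℝ)) (by
      intro i j hij
      have : ((i : ℕ) : ℝ) < ((j : ℕ) : ℝ) := by exact_mod_cast hij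
      simpa using this)
    have hd : ht (addRoot χ' a b) = ht χ' + r := by
      rw [← hr']
      simp only [ht]
      rw [← Finset.sum_add_distrib]
      refine Finset.sum_congr rfl fun i _ => ?_
      push_cast
      ring
    simp only [id, hd, Complex.add_re, Complex.ofReal_re] at this
    linarith
  · rcases hχ' with rfl | h
    · exact hab'
    · exact hab'.trans h

/-- The Casimir operator. -/
def casimir : Module.End ℂ V := ∑ i, ∑ j, D.e i j * D.e j i

theorem casimir_apply (x : V) : D.casimir x = ∑ i, ∑ j, D.e i j (D.e j i x) := by
  simp [casimir, LinearMap.sum_apply]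

/-- The commutators with the two factors contribute four double sums, which cancel in pairs. -/
theorem casimir_e (k l : Fin (n + 1)) (x : V) :
    D.casimir (D.e k l x) = D.e k l (D.casimir x) := by
  have h : ∀ i j, D.e k l (D.e i j (D.e j i x)) = D.e i j (D.e j i (D.e k l x)) +
      ((if l = i then D.e k j (D.e j i x) else 0) - (if j = k then D.e i l (D.e j i x) else 0)) +
      ((if l = j then D.e i j (D.e k i x) else 0) -
        (if i = k then D.e i j (D.e j l x) else 0)) := by
    intro i j
    rw [D.e_e k l i j, D.e_e k l j i, map_sub, map_add]
    simp only [apply_ite (D.e i j), map_zero]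
    abel
  simp only [casimir_apply, map_sum, h, Finset.sum_add_distrib, Finset.sum_sub_distrib]
  have h1 : ∑ i, ∑ j, (if l = i then D.e k j (D.e j i x) else 0) =
      ∑ j, D.e k j (D.e j l x) := by
    rw [Finset.sum_comm]; simp
  have h2 : ∑ i, ∑ j, (if j = k then D.e i l (D.e j i x) else 0) =
      ∑ i, D.e i l (D.e k i x) := by simp
  have h3 : ∑ i, ∑ j, (if l = j then D.e i j (D.e k i x) else 0) =
      ∑ i, D.e i l (D.e k i x) := by simp
  have h4 : ∑ i, ∑ j, (if i = k then D.e i j (D.e j l x) else 0) =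
      ∑ j, D.e k j (D.e j l x) := by
    rw [Finset.sum_comm]; simp
  rw [h1, h2, h3, h4]
  abel

theorem casimir_apply_of_mem_highest {χ : Fin (n + 1) → ℂ} {x : V} (hx : x ∈ D.highest χ) :
    D.casimir x = casimirValue χ • x := by
  rw [mem_highest] at hx
  have hx' := D.mem_weightSpace.mp hx.1
  rw [casimir_apply, casimirValue, Finset.sum_smul]
  refine Finset.sum_congr rfl fun i _ => ?_
  rw [Finset.sum_smul]
  refine Finset.sum_congr rfl fun j _ => ?_
  rcases lt_trichotomy i j with h | h | h
  · rw [if_neg h.ne, if_pos h, D.e_e_apply_of_mem_weightSpace hx.1, hx.2 i j h, map_zero, zero_add]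
  · subst h
    rw [if_pos rfl, hx', map_smul, hx', smul_smul, sq]
  · rw [if_neg h.ne', if_neg h.not_gt, hx.2 j i h, map_zero, zero_smul]

/-- The span of the vectors `e b a y` with `a < b` and `y` a weight vector. -/
def lower : Submodule ℂ V :=
  Submodule.span ℂ {x | ∃ a b, a < b ∧ ∃ χ, ∃ y ∈ D.weightSpace χ, x = D.e b a y}

theorem e_mem_lower {χ : Fin (n + 1) → ℂ} {y : V} (hy : y ∈ D.weightSpace χ) {a b : Fin (n + 1)}
    (h : a < b) : D.e b a y ∈ D.lower :=
  Submodule.subset_span ⟨a, b, h, χ, y, hy, rfl⟩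

theorem iSupIndep_weightSpace : iSupIndep D.weightSpace := by
  have h := Module.End.independent_iInf_maxGenEigenspace_of_forall_mapsTo
    (fun i => D.e i i) (fun i j φ => Module.End.mapsTo_maxGenEigenspace_of_comm (by
      ext x
      simp only [Module.End.mul_apply]
      rw [D.e_e]
      rcases eq_or_ne i j with rfl | hij
      · simp
      · simp [hij, hij.symm]) φ)
  refine h.mono fun χ => ?_
  refine iInf_mono fun i => ?_
  exact (Module.End.genEigenspace (D.e i i) (χ i)).monotone le_top

/-- A weight vector in the span of a set of weight vectors is in the span of those of its
weight. -/
theorem mem_span_of_mem_weightSpace {S : Set V} {χ : Fin (n + 1) → ℂ} {x : V}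
    (hS : ∀ s ∈ S, ∃ ψ, s ∈ D.weightSpace ψ) (hx : x ∈ D.weightSpace χ)
    (hxS : x ∈ Submodule.span ℂ S) : x ∈ Submodule.span ℂ {s ∈ S | s ∈ D.weightSpace χ} := by
  have h1 : Submodule.span ℂ S ≤ Submodule.span ℂ {s ∈ S | s ∈ D.weightSpace χ} ⊔
      ⨆ ψ, ⨆ _ : ψ ≠ χ, D.weightSpace ψ := by
    rw [Submodule.span_le]
    intro s hs
    obtain ⟨ψ, hψ⟩ := hS s hs
    by_cases h : ψ = χ
    · subst h
      exact Submodule.mem_sup_left (Submodule.subset_span ⟨hs, hψ⟩)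
    · exact Submodule.mem_sup_right
        (Submodule.mem_iSup_of_mem ψ (Submodule.mem_iSup_of_mem h hψ))
  obtain ⟨y, hy, z, hz, rfl⟩ := Submodule.mem_sup.mp (h1 hxS)
  have hy' : y ∈ D.weightSpace χ :=
    Submodule.span_le.mpr (fun s hs => hs.2) hy
  have hz' : z ∈ D.weightSpace χ := by simpa using Submodule.sub_mem _ hx hy'
  have := Submodule.disjoint_def.mp (D.iSupIndep_weightSpace χ) z hz' hz
  rwa [this, add_zero]

/-- No nonzero highest weight vector is a sum of lowered weight vectors. -/
theorem eq_zero_of_mem_highest_of_mem_lower [FiniteDimensional ℂ V] {χ : Fin (n + 1) → ℂ} {x : V}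
    (hx : x ∈ D.highest χ) (hl : x ∈ D.lower) : x = 0 := by
  by_contra hx0
  have hdom := D.dominant_of_mem_highest hx hx0
  -- `T` kills `x` and commutes with every `e a b`. Below, `x` is shown to lie also in the range of
  -- a high power of `T`, which meets the kernel of that power trivially.
  let T : Module.End ℂ V := D.casimir - algebraMap ℂ _ (casimirValue χ)
  have hT : ∀ y, T y = D.casimir y - casimirValue χ • y := fun y => rfl
  have hTe : ∀ a b, Commute T (D.e a b) := by
    intro a b
    ext y
    simp only [Module.End.mul_apply, hT, casimir_e, map_sub, map_smul]
  have hTw : ∀ ψ, ∀ y ∈ D.weightSpace ψ, T y ∈ D.weightSpace ψ := by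
    intro ψ y hy
    rw [mem_weightSpace] at hy ⊢
    intro i
    rw [← Module.End.mul_apply, ← (hTe i i).eq, Module.End.mul_apply, hy i, map_smul]
  -- A kernel vector of weight above `χ` could be raised, inside the kernel, to a highest weight
  -- vector with the Casimir value of `χ`, against `Above.casimirValue_ne`.
  have hinj : ∀ ψ, Above ψ χ → ∀ y ∈ D.weightSpace ψ, T y = 0 → y = 0 := by
    intro ψ hψ y hy hy0
    by_contra hne
    obtain ⟨ψ', h, z, hz, hzK, hz0⟩ := D.exists_mem_highest (K := LinearMap.ker T)
      (fun a b u hu => by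
        rw [LinearMap.mem_ker] at hu ⊢
        rw [← Module.End.mul_apply, (hTe a b).eq, Module.End.mul_apply, hu, map_zero])
      hy hy0 hne
    have hab : Above ψ' χ := by
      rcases h with rfl | h
      · exact hψ
      · exact h.trans hψ
    refine hab.casimirValue_ne (D.dominant_of_mem_highest hz hz0) hdom ?_
    rw [LinearMap.mem_ker, hT, D.casimir_apply_of_mem_highest hz, ← sub_smul] at hzK
    exact sub_eq_zero.mp ((smul_eq_zero.mp hzK).resolve_right hz0)
  have hsurj : ∀ ψ, Above ψ χ → ∀ k : ℕ, ∀ y ∈ D.weightSpace ψ, ∃ z, (T ^ k) z = y := by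
    intro ψ hψ k y hy
    let Tr := T.restrict (hTw ψ)
    have hTr : Function.Injective Tr := by
      rw [← LinearMap.ker_eq_bot, LinearMap.ker_eq_bot']
      rintro ⟨u, hu⟩ h
      exact Subtype.ext (hinj ψ hψ u hu (congrArg Subtype.val h))
    have hs : Function.Surjective (Tr ^ k) := by
      rw [Module.End.coe_pow]
      exact (LinearMap.injective_iff_surjective.mp hTr).iterate k
    obtain ⟨z, hz⟩ := hs ⟨y, hy⟩
    refine ⟨z.1, ?_⟩
    have := congrArg Subtype.val hz
    rwa [Module.End.pow_restrict] at this
  obtain ⟨k, hk⟩ := Filter.eventually_atTop.mp T.eventually_isCompl_ker_pow_range_pow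
  have hdisj := (hk (k + 1) (Nat.le_succ k)).disjoint
  refine hx0 (Submodule.disjoint_def.mp hdisj x ?_ ?_)
  · rw [LinearMap.mem_ker, pow_succ, Module.End.mul_apply, hT, D.casimir_apply_of_mem_highest hx,
      sub_self, map_zero]
  -- Only the terms `e b a y` of weight `χ` matter. Then `y` has weight above `χ`, hence is in the
  -- range of the power of `T`, and so is `e b a y`.
  · have := D.mem_span_of_mem_weightSpace (by
      rintro _ ⟨a, b, -, ψ, y, hy, rfl⟩
      exact ⟨_, D.e_mem_weightSpace hy b a⟩) (D.mem_highest.mp hx).1 hl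
    refine Submodule.span_le.mpr ?_ this
    rintro _ ⟨⟨a, b, hab, ψ, y, hy, rfl⟩, hw⟩
    by_cases h0 : D.e b a y = 0
    · rw [h0]; exact Submodule.zero_mem _
    have hψ : χ = addRoot ψ b a := by
      have h1 := D.mem_weightSpace.mp hw
      have h2 := D.mem_weightSpace.mp (D.e_mem_weightSpace hy b a)
      funext i
      exact smul_left_injective ℂ h0 ((h1 i).symm.trans (h2 i))
    have hab' : Above ψ χ := by
      have : ψ = addRoot χ a b := by
        funext i
        simp only [hψ, addRoot]
        ring
      rw [this]
      exact above_addRoot χ hab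
    obtain ⟨z, rfl⟩ := hsurj ψ hab' (k + 1) y hy
    refine ⟨D.e b a z, ?_⟩
    rw [← Module.End.mul_apply, ((hTe b a).pow_left (k + 1)).eq, Module.End.mul_apply]

end OperatorSystem

/-! ### Operators between spaces of highest weight vectors -/

/-- `-(χ_l - χ_b + b - l)`. -/
def gap {n : ℕ} (χ : Fin (n + 1) → ℂ) (b l : Fin (n + 1)) : ℂ :=
  -(χ l - χ b + (((b : ℕ) : ℂ) - ((l : ℕ) : ℂ)))

theorem Dominant.gap_eq {n : ℕ} {χ : Fin (n + 1) → ℂ} (hχ : Dominant χ) {b l : Fin (n + 1)}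
    (h : l < b) : ∃ m : ℕ, gap χ b l = -((m : ℂ) + 1) := by
  obtain ⟨m, hm⟩ := hχ l b h
  have h' : (l : ℕ) < b := h
  refine ⟨m + ((b : ℕ) - (l : ℕ) - 1), ?_⟩
  have : ((b : ℕ) : ℂ) - ((l : ℕ) : ℂ) = (((b : ℕ) - (l : ℕ) - 1 : ℕ) : ℂ) + 1 := by
    rw [sub_eq_iff_eq_add]
    norm_cast
    omega
  rw [gap, hm, this]
  push_cast
  ring

theorem Dominant.gap_ne_zero {n : ℕ} {χ : Fin (n + 1) → ℂ} (hχ : Dominant χ) {b l : Fin (n + 1)}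
    (h : l < b) : gap χ b l ≠ 0 := by
  obtain ⟨m, hm⟩ := hχ.gap_eq h
  rw [hm, neg_ne_zero]
  exact Nat.cast_add_one_ne_zero m

theorem Dominant.one_sub_gap_inv_ne_zero {n : ℕ} {χ : Fin (n + 1) → ℂ} (hχ : Dominant χ)
    {b l : Fin (n + 1)} (h : l < b) : 1 - (gap χ b l)⁻¹ ≠ 0 := by
  obtain ⟨m, hm⟩ := hχ.gap_eq h
  rw [sub_ne_zero]
  intro h1
  have h2 : gap χ b l = 1 := by rw [← inv_inv (gap χ b l), ← h1, inv_one]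
  rw [hm] at h2
  have h3 : ((m + 1 + 1 : ℕ) : ℂ) = 0 := by
    push_cast
    linear_combination -h2
  exact absurd h3 (Nat.cast_ne_zero.mpr (by omega))

/-- The weight `χ + ε_b`, where `ε_b` is the weight of the `b`-th standard basis vector. -/
def shift {n : ℕ} (χ : Fin (n + 1) → ℂ) (b : Fin (n + 1)) : Fin (n + 1) → ℂ := fun i =>
  χ i + (if i = b then 1 else 0) - ((n : ℂ) + 1)⁻¹

/-- Iterated `shift`. -/
def shiftList {n : ℕ} (χ : Fin (n + 1) → ℂ) : List (Fin (n + 1)) → Fin (n + 1) → ℂ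
  | [] => χ
  | b :: L => shift (shiftList χ L) b

theorem shiftList_apply {n : ℕ} (χ : Fin (n + 1) → ℂ) (L : List (Fin (n + 1)))
    (i : Fin (n + 1)) :
    shiftList χ L i = χ i + L.count i - L.length * ((n : ℂ) + 1)⁻¹ := by
  induction L with
  | nil => simp [shiftList]
  | cons b L ih =>
    simp only [shiftList, shift, ih, List.count_cons, List.length_cons, beq_iff_eq,
      @eq_comm _ b i]
    push_cast
    ring

theorem shiftList_perm {n : ℕ} (χ : Fin (n + 1) → ℂ) {L L' : List (Fin (n + 1))}
    (h : L.Perm L') : shiftList χ L = shiftList χ L' := by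
  funext i
  rw [shiftList_apply, shiftList_apply, h.count_eq, h.length_eq]

theorem shiftList_append {n : ℕ} (χ : Fin (n + 1) → ℂ) (L L' : List (Fin (n + 1))) :
    shiftList χ (L ++ L') = shiftList (shiftList χ L') L := by
  induction L with
  | nil => rfl
  | cons b L ih => simp only [List.cons_append, shiftList, ih]

namespace OperatorSystem

variable {n : ℕ} {V : Type*} [AddCommGroup V] [Module ℂ V] (D : OperatorSystem n V)

theorem p_mem_weightSpace {χ : Fin (n + 1) → ℂ} {x : V} (hx : x ∈ D.weightSpace χ)
    (b : Fin (n + 1)) : D.p b x ∈ D.weightSpace (shift χ b) := by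
  rw [mem_weightSpace] at hx ⊢
  intro i
  rw [D.e_p, hx i, map_smul, if_pos rfl]
  simp only [shift, sub_smul, add_smul, ite_smul, one_smul, zero_smul]
  split_ifs <;> simp_all

/-- The other raising operators are iterated commutators of the simple ones. -/
theorem mem_highest_of_simple {χ : Fin (n + 1) → ℂ} {x : V} (hx : x ∈ D.weightSpace χ)
    (h : ∀ k j : Fin (n + 1), (j : ℕ) = k + 1 → D.e k j x = 0) : x ∈ D.highest χ := by
  refine D.mem_highest.mpr ⟨hx, ?_⟩
  have key : ∀ (d : ℕ) (a b : Fin (n + 1)), (b : ℕ) = a + 1 + d → D.e a b x = 0 := by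
    intro d
    induction d with
    | zero => exact h
    | succ d ih =>
      intro a b hab
      let j : Fin (n + 1) := ⟨a + 1 + d, by have := b.isLt; omega⟩
      have h1 := ih a j rfl
      have h2 := h j b hab
      have hba : b ≠ a := fun h => by rw [h] at hab; omega
      have := D.e_e a j j b x
      rw [h1, h2, if_pos rfl, if_neg hba, map_zero, map_zero, zero_add, sub_zero] at this
      exact this.symm
  intro a b hab
  exact key (b - a - 1) a b (by have : (a : ℕ) < b := hab; omega)

/-- The sums `∑ (gap a_r ⋯ gap a_1)⁻¹ e a a_r ⋯ e a_2 a_1 p a_1` over all sequences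
`a > a_r > ⋯ > a_1`. -/
def descend (χ : Fin (n + 1) → ℂ) (b a : Fin (n + 1)) : Module.End ℂ V :=
  D.p a + ∑ l ∈ (Finset.Iio a).attach, (gap χ b l.1)⁻¹ • (D.e a l.1 * descend χ b l.1)
termination_by a.val
decreasing_by exact Fin.lt_def.mp (Finset.mem_Iio.mp l.2)

theorem descend_apply (χ : Fin (n + 1) → ℂ) (b a : Fin (n + 1)) (x : V) :
    D.descend χ b a x =
      D.p a x + ∑ l ∈ Finset.Iio a, (gap χ b l)⁻¹ • D.e a l (D.descend χ b l x) := by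
  rw [descend, ← Finset.sum_attach (Finset.Iio a)]
  simp [LinearMap.sum_apply]

/-- The normalised operator which maps highest weight vectors of weight `χ` to highest weight
vectors of weight `χ + ε_b`. -/
def psi (χ : Fin (n + 1) → ℂ) (b : Fin (n + 1)) : Module.End ℂ V := D.descend χ b b

theorem addRoot_shift (χ : Fin (n + 1) → ℂ) (a l : Fin (n + 1)) :
    addRoot (shift χ l) a l = shift χ a := by
  funext i
  simp only [addRoot, shift]
  ring

theorem descend_mem_weightSpace {χ ψ : Fin (n + 1) → ℂ} {x : V} (hx : x ∈ D.weightSpace ψ)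
    (b a : Fin (n + 1)) : D.descend χ b a x ∈ D.weightSpace (shift ψ a) := by
  induction a using WellFoundedLT.induction with
  | ind a ih =>
    rw [descend_apply]
    refine Submodule.add_mem _ (D.p_mem_weightSpace hx a) (Submodule.sum_mem _ fun l hl => ?_)
    refine Submodule.smul_mem _ _ ?_
    rw [← addRoot_shift ψ a l]
    exact D.e_mem_weightSpace (ih l (Finset.mem_Iio.mp hl)) a l

/-- This recursion dictates the coefficients in `descend`. At `a = b = j` the factor `gap χ b b = 0`
makes `psi` produce highest weight vectors. -/
theorem e_descend {χ : Fin (n + 1) → ℂ} (hχ : Dominant χ) {z : V} (hz : z ∈ D.highest χ)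
    {b k j : Fin (n + 1)} (hkj : (j : ℕ) = k + 1) (a : Fin (n + 1)) (hab : a ≤ b) :
    D.e k j (D.descend χ b a z) =
      if a = j then (gap χ b j / gap χ b k) • D.descend χ b k z else 0 := by
  have hkj' : k < j := Fin.lt_def.mpr (by omega)
  rw [mem_highest] at hz
  induction a using WellFoundedLT.induction with
  | ind a ih =>
    have hp : D.e k j (D.p a z) = if a = j then D.p k z else 0 := by
      rw [D.e_p, hz.2 k j hkj', map_zero, zero_add, if_neg hkj'.ne, sub_zero]
      simp only [eq_comm]
    have hl : ∀ l ∈ Finset.Iio a, D.e k j ((gap χ b l)⁻¹ • D.e a l (D.descend χ b l z)) =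
        (gap χ b l)⁻¹ • ((if l = j then (gap χ b j / gap χ b k) • D.e a l (D.descend χ b k z)
          else 0) + (if j = a then D.e k l (D.descend χ b l z) else 0) -
          (if l = k then D.e a j (D.descend χ b l z) else 0)) := by
      intro l hl
      have hla := Finset.mem_Iio.mp hl
      rw [map_smul, D.e_e, ih l hla (hla.le.trans hab)]
      simp only [apply_ite (D.e a l), map_zero, map_smul]
    rw [descend_apply, map_add, map_sum, hp, Finset.sum_congr rfl hl]
    rcases lt_trichotomy a j with haj | rfl | haj
    · rw [if_neg haj.ne, if_neg haj.ne, zero_add]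
      refine Finset.sum_eq_zero fun l hl => ?_
      have hla := Finset.mem_Iio.mp hl
      have h1 : l ≠ j := (hla.trans haj).ne
      have h2 : l ≠ k := by
        intro h
        subst h
        have h3 : (l : ℕ) < a := hla
        have h4 : (a : ℕ) < j := haj
        omega
      rw [if_neg h1, if_neg haj.ne', if_neg h2]
      simp
    · rw [if_pos rfl, if_pos rfl]
      -- The terms `l < k` combine with `p k` to `descend χ b k`. The term `l = k` contributes a
      -- multiple of the same vector by a weight difference, which turns the factor `1` into `gap χ
      -- b j / gap χ b k`.
      have hI : Finset.Iio a = insert k (Finset.Iio k) := by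
        ext l
        simp only [Finset.mem_Iio, Finset.mem_insert, Fin.lt_def, Fin.ext_iff]
        omega
      rw [hI, Finset.sum_insert (by simp)]
      have hrest : ∑ l ∈ Finset.Iio k, (gap χ b l)⁻¹ • ((if l = a then
          (gap χ b a / gap χ b k) • D.e a l (D.descend χ b k z) else 0) +
          (if a = a then D.e k l (D.descend χ b l z) else 0) -
          (if l = k then D.e a a (D.descend χ b l z) else 0)) =
          ∑ l ∈ Finset.Iio k, (gap χ b l)⁻¹ • D.e k l (D.descend χ b l z) := by
        refine Finset.sum_congr rfl fun l hl => ?_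
        have hlk := Finset.mem_Iio.mp hl
        rw [if_neg (hlk.trans hkj').ne, if_neg hlk.ne, if_pos rfl, zero_add, sub_zero]
      rw [hrest, if_neg hkj'.ne, if_pos rfl, if_pos rfl, zero_add, add_left_comm,
        ← descend_apply]
      have hw := D.mem_weightSpace.mp (D.descend_mem_weightSpace (χ := χ) hz.1 b k)
      rw [hw, hw, ← sub_smul, smul_smul]
      nth_rw 2 [← one_smul ℂ (D.descend χ b k z)]
      rw [← add_smul]
      congr 1
      have hg : gap χ b k ≠ 0 := hχ.gap_ne_zero (hkj'.trans_le hab)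
      have hg' : gap χ b a = gap χ b k + (χ k - χ a + 1) := by
        simp only [gap, hkj]
        push_cast
        ring
      rw [hg']
      simp only [shift, if_true, if_neg hkj'.ne']
      field_simp
      ring
    · rw [if_neg haj.ne', if_neg haj.ne', zero_add]
      have hka := hkj'.trans haj
      have hg : gap χ b k ≠ 0 := hχ.gap_ne_zero (hka.trans_le hab)
      have hg' : gap χ b j ≠ 0 := hχ.gap_ne_zero (haj.trans_le hab)
      -- Only `l = j` and `l = k` survive, and they cancel.
      simp only [if_neg haj.ne, add_zero, smul_sub, Finset.sum_sub_distrib, smul_ite, smul_zero,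
        Finset.sum_ite_eq', Finset.mem_Iio, haj, hka, if_true]
      rw [smul_smul, sub_eq_zero]
      congr 1
      field_simp

theorem psi_sub_mem_lower {χ ψ : Fin (n + 1) → ℂ} {y : V} (hy : y ∈ D.weightSpace ψ)
    (c : Fin (n + 1)) : D.psi χ c y - D.p c y ∈ D.lower := by
  rw [psi, descend_apply, add_sub_cancel_left]
  refine Submodule.sum_mem _ fun l hl => Submodule.smul_mem _ _ ?_
  exact D.e_mem_lower (D.descend_mem_weightSpace hy _ _) (Finset.mem_Iio.mp hl)

theorem p_e_apply (c b l : Fin (n + 1)) (h : b ≠ l) (y : V) :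
    D.p c (D.e b l y) = D.e b l (D.p c y) - if l = c then D.p b y else 0 := by
  rw [D.e_p, if_neg h, sub_zero, add_sub_cancel_right]

/-- Moving `p c` to the right of the outer `e b l` costs a commutator only for `l = c`, namely `-p
b`. What remains there is `p b (descend χ b c z)`, congruent to `p b (p c z)` because `p b` commutes
with every `e c m`, `m < c < b`. -/
theorem p_psi_sub_mem_lower {χ : Fin (n + 1) → ℂ} {z : V}
    (hz : z ∈ D.weightSpace χ) (b c : Fin (n + 1)) :
    D.p c (D.psi χ b z) - (1 - if c < b then (gap χ b c)⁻¹ else 0) • D.p c (D.p b z) ∈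
      D.lower := by
  have hl : ∀ l ∈ Finset.Iio b, D.p c ((gap χ b l)⁻¹ • D.e b l (D.descend χ b l z)) =
      (gap χ b l)⁻¹ • D.e b l (D.p c (D.descend χ b l z)) -
        if l = c then (gap χ b l)⁻¹ • D.p b (D.descend χ b l z) else 0 := by
    intro l hl
    rw [map_smul, D.p_e_apply c b l (Finset.mem_Iio.mp hl).ne', smul_sub, smul_ite, smul_zero]
  rw [psi, descend_apply, map_add, map_sum, Finset.sum_congr rfl hl, Finset.sum_sub_distrib,
    Finset.sum_ite_eq']
  have h1 : ∑ l ∈ Finset.Iio b, (gap χ b l)⁻¹ • D.e b l (D.p c (D.descend χ b l z)) ∈ D.lower :=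
    Submodule.sum_mem _ fun l hl => Submodule.smul_mem _ _
      (D.e_mem_lower (D.p_mem_weightSpace (D.descend_mem_weightSpace hz _ _) _)
        (Finset.mem_Iio.mp hl))
  by_cases hcb : c < b
  · rw [if_pos (Finset.mem_Iio.mpr hcb), if_pos hcb]
    have h2 : D.p b (D.descend χ b c z) - D.p b (D.p c z) ∈ D.lower := by
      rw [descend_apply, map_add, add_sub_cancel_left, map_sum]
      refine Submodule.sum_mem _ fun m hm => ?_
      have hmc := Finset.mem_Iio.mp hm
      rw [map_smul, D.p_e_apply b c m hmc.ne', if_neg (hmc.trans hcb).ne, sub_zero]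
      exact Submodule.smul_mem _ _ (D.e_mem_lower
        (D.p_mem_weightSpace (D.descend_mem_weightSpace hz _ _) _) hmc)
    rw [D.p_p c b]
    convert Submodule.sub_mem _ h1 (Submodule.smul_mem _ (gap χ b c)⁻¹ h2) using 1
    rw [sub_smul, one_smul, smul_sub]
    abel
  · rw [if_neg (by simpa using hcb), if_neg hcb, sub_zero, sub_zero, one_smul,
      add_sub_cancel_left]
    exact h1

section FiniteDimensional

variable [FiniteDimensional ℂ V]

theorem psi_mem_highest {χ : Fin (n + 1) → ℂ} {z : V} (hz : z ∈ D.highest χ) (b : Fin (n + 1)) :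
    D.psi χ b z ∈ D.highest (shift χ b) := by
  rcases eq_or_ne z 0 with rfl | h0
  · rw [map_zero]; exact Submodule.zero_mem _
  refine D.mem_highest_of_simple (D.descend_mem_weightSpace (D.mem_highest.mp hz).1 b b) ?_
  intro k j hkj
  rw [psi, D.e_descend (D.dominant_of_mem_highest hz h0) hz hkj b le_rfl]
  split_ifs with h
  · subst h
    simp [gap]
  · rfl

/-- The operators `psi` commute up to nonzero scalars. -/
theorem psi_psi {χ : Fin (n + 1) → ℂ} {z : V} (hz : z ∈ D.highest χ) (b c : Fin (n + 1)) :
    ∃ κ : ℂ, κ ≠ 0 ∧ D.psi (shift χ b) c (D.psi χ b z) =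
      κ • D.psi (shift χ c) b (D.psi χ c z) := by
  rcases eq_or_ne z 0 with rfl | h0
  · exact ⟨1, one_ne_zero, by simp⟩
  have hdom := D.dominant_of_mem_highest hz h0
  have hne : ∀ b c, (1 - if c < b then (gap χ b c)⁻¹ else 0) ≠ 0 := by
    intro b c
    split_ifs with h
    · exact hdom.one_sub_gap_inv_ne_zero h
    · simp
  -- Modulo `lower` both orders are nonzero multiples of the same vector `p c (p b z)`. The right
  -- combination of them is therefore a highest weight vector in `lower`, hence zero.
  have hmod : ∀ b c, D.psi (shift χ b) c (D.psi χ b z) -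
      (1 - if c < b then (gap χ b c)⁻¹ else 0) • D.p c (D.p b z) ∈ D.lower := by
    intro b c
    convert Submodule.add_mem _
      (D.psi_sub_mem_lower (χ := shift χ b) (D.mem_highest.mp (D.psi_mem_highest hz b)).1 c)
      (D.p_psi_sub_mem_lower (D.mem_highest.mp hz).1 b c) using 1
    abel
  have h1 := hmod b c
  have h2 := hmod c b
  rw [D.p_p b c] at h2
  generalize hκ₁ : (1 - if c < b then (gap χ b c)⁻¹ else 0) = κ₁ at h1
  generalize hκ₂ : (1 - if b < c then (gap χ c b)⁻¹ else 0) = κ₂ at h2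
  have hκ₁' : κ₁ ≠ 0 := hκ₁ ▸ hne b c
  have hκ₂' : κ₂ ≠ 0 := hκ₂ ▸ hne c b
  refine ⟨κ₁ / κ₂, div_ne_zero hκ₁' hκ₂', sub_eq_zero.mp ?_⟩
  refine D.eq_zero_of_mem_highest_of_mem_lower (χ := shift (shift χ b) c) ?_ ?_
  · refine Submodule.sub_mem _ (D.psi_mem_highest (D.psi_mem_highest hz b) c)
      (Submodule.smul_mem _ _ ?_)
    have : shift (shift χ b) c = shift (shift χ c) b := by
      funext i
      simp only [shift]
      ring
    rw [this]
    exact D.psi_mem_highest (D.psi_mem_highest hz c) b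
  · convert Submodule.sub_mem _ h1 (Submodule.smul_mem _ (κ₁ / κ₂) h2) using 1
    rw [smul_sub, smul_smul, div_mul_cancel₀ _ hκ₂']
    abel

end FiniteDimensional

/-! ### Words in `psi` and the submodule generated by a highest weight vector -/

/-- Iterated `psi`, with the weight updated at each step. -/
def psiList (χ : Fin (n + 1) → ℂ) : List (Fin (n + 1)) → Module.End ℂ V
  | [] => 1
  | b :: L => D.psi (shiftList χ L) b * psiList χ L

theorem psiList_append (χ : Fin (n + 1) → ℂ) (L L' : List (Fin (n + 1))) :
    D.psiList χ (L ++ L') = D.psiList (shiftList χ L') L * D.psiList χ L' := by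
  induction L with
  | nil => simp [psiList]
  | cons b L ih => simp only [List.cons_append, psiList, ih, shiftList_append, mul_assoc]

section Intertwine

variable {V' : Type*} [AddCommGroup V'] [Module ℂ V'] {D' : OperatorSystem n V'}
  {f : V →ₗ[ℂ] V'}

theorem map_psiList (he : ∀ i j x, f (D.e i j x) = D'.e i j (f x))
    (hp : ∀ i x, f (D.p i x) = D'.p i (f x)) (χ : Fin (n + 1) → ℂ) (L : List (Fin (n + 1)))
    (x : V) : f (D.psiList χ L x) = D'.psiList χ L (f x) := by
  have hd : ∀ χ b a x, f (D.descend χ b a x) = D'.descend χ b a (f x) := by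
    intro χ b a x
    induction a using WellFoundedLT.induction with
    | ind a ih =>
      rw [descend_apply, descend_apply, map_add, hp, map_sum]
      congr 1
      refine Finset.sum_congr rfl fun l hl => ?_
      rw [map_smul, he, ih l (Finset.mem_Iio.mp hl)]
  induction L with
  | nil => rfl
  | cons b L ih => simp only [psiList, Module.End.mul_apply, psi, hd, ih]

end Intertwine

section Stable

/-- Stability under the operators `e i j` and `p k`. -/
def IsStable (W : Submodule ℂ V) : Prop :=
  (∀ i j, ∀ x ∈ W, D.e i j x ∈ W) ∧ ∀ k, ∀ x ∈ W, D.p k x ∈ W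

/-- The stable subspace generated by a vector. -/
def generated (v : V) : Submodule ℂ V := sInf {W | D.IsStable W ∧ v ∈ W}

theorem mem_generated_self (v : V) : v ∈ D.generated v :=
  Submodule.mem_sInf.mpr fun _ hW => hW.2

theorem generated_le {v : V} {W : Submodule ℂ V} (hW : D.IsStable W) (hv : v ∈ W) :
    D.generated v ≤ W := sInf_le ⟨hW, hv⟩

theorem isStable_generated (v : V) : D.IsStable (D.generated v) :=
  ⟨fun i j x hx => Submodule.mem_sInf.mpr fun W hW =>
      hW.1.1 i j x (Submodule.mem_sInf.mp hx W hW),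
    fun k x hx => Submodule.mem_sInf.mpr fun W hW =>
      hW.1.2 k x (Submodule.mem_sInf.mp hx W hW)⟩

theorem IsStable.psiList_mem {D : OperatorSystem n V} {W : Submodule ℂ V} (hW : D.IsStable W)
    (χ : Fin (n + 1) → ℂ) (L : List (Fin (n + 1))) {x : V} (hx : x ∈ W) :
    D.psiList χ L x ∈ W := by
  have hd : ∀ χ b a, ∀ x ∈ W, D.descend χ b a x ∈ W := by
    intro χ b a x hx
    induction a using WellFoundedLT.induction with
    | ind a ih =>
      rw [descend_apply]
      exact Submodule.add_mem _ (hW.2 _ _ hx) (Submodule.sum_mem _ fun l hl =>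
        Submodule.smul_mem _ _ (hW.1 _ _ _ (ih l (Finset.mem_Iio.mp hl))))
  induction L with
  | nil => exact hx
  | cons b L ih => exact hd _ _ _ _ ih

/-- The vectors obtained from the highest weight vectors `psiList χ L v` by applying lowering
operators, with their weights. -/
inductive Lowered (χ : Fin (n + 1) → ℂ) (v : V) : (Fin (n + 1) → ℂ) → V → Prop
  | base (L : List (Fin (n + 1))) : Lowered χ v (shiftList χ L) (D.psiList χ L v)
  | step {ψ : Fin (n + 1) → ℂ} {y : V} {a b : Fin (n + 1)} (h : a < b) :
      Lowered χ v ψ y → Lowered χ v (addRoot ψ b a) (D.e b a y)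

/-- The span of the vectors `Lowered`. -/
def loweredSpan (χ : Fin (n + 1) → ℂ) (v : V) : Submodule ℂ V :=
  Submodule.span ℂ {y | ∃ ψ, D.Lowered χ v ψ y}

theorem Lowered.mem {D : OperatorSystem n V} {χ ψ : Fin (n + 1) → ℂ} {v y : V}
    (h : D.Lowered χ v ψ y) : y ∈ D.loweredSpan χ v := Submodule.subset_span ⟨ψ, h⟩

theorem e_mem_loweredSpan_of_lt {χ : Fin (n + 1) → ℂ} {v x : V} {a b : Fin (n + 1)} (h : a < b)
    (hx : x ∈ D.loweredSpan χ v) : D.e b a x ∈ D.loweredSpan χ v := by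
  have : D.loweredSpan χ v ≤ (D.loweredSpan χ v).comap (D.e b a) := by
    refine Submodule.span_le.mpr ?_
    rintro y ⟨ψ, hy⟩
    exact (Lowered.step h hy).mem
  exact this hx

/-- Strong induction on `c`: `p c` is `psi` minus lowering operators applied to `descend` terms of
smaller index, and those involve only `p l` with `l < c`. -/
theorem p_psiList_mem_loweredSpan (χ : Fin (n + 1) → ℂ) (v : V)
    (L : List (Fin (n + 1))) (c : Fin (n + 1)) :
    D.p c (D.psiList χ L v) ∈ D.loweredSpan χ v := by
  induction c using WellFoundedLT.induction with
  | ind c ih =>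
    have hd : ∀ l < c, D.descend (shiftList χ L) c l (D.psiList χ L v) ∈ D.loweredSpan χ v := by
      intro l hl
      induction l using WellFoundedLT.induction with
      | ind l ihl =>
        rw [descend_apply]
        refine Submodule.add_mem _ (ih l hl) (Submodule.sum_mem _ fun m hm => ?_)
        have hm' := Finset.mem_Iio.mp hm
        exact Submodule.smul_mem _ _ (D.e_mem_loweredSpan_of_lt hm' (ihl m hm' (hm'.trans hl)))
    have h1 : D.descend (shiftList χ L) c c (D.psiList χ L v) ∈ D.loweredSpan χ v :=
      (Lowered.base (D := D) (χ := χ) (v := v) (c :: L)).mem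
    rw [descend_apply] at h1
    refine (Submodule.add_mem_iff_left _ (Submodule.sum_mem _ fun l hl => ?_)).mp h1
    have hl' := Finset.mem_Iio.mp hl
    exact Submodule.smul_mem _ _ (D.e_mem_loweredSpan_of_lt hl' (hd l hl'))

theorem Lowered.p_mem_loweredSpan {D : OperatorSystem n V} {χ ψ : Fin (n + 1) → ℂ} {v y : V}
    (h : D.Lowered χ v ψ y) (k : Fin (n + 1)) :
    D.p k y ∈ D.loweredSpan χ v := by
  induction h generalizing k with
  | base L => exact D.p_psiList_mem_loweredSpan χ v L k
  | step hab hy ih =>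
    rw [D.p_e_apply _ _ _ hab.ne']
    refine Submodule.sub_mem _ (D.e_mem_loweredSpan_of_lt hab (ih k)) ?_
    split_ifs
    · exact ih _
    · exact Submodule.zero_mem _

variable [FiniteDimensional ℂ V]

theorem psiList_mem_highest {χ : Fin (n + 1) → ℂ} {v : V} (hv : v ∈ D.highest χ)
    (L : List (Fin (n + 1))) : D.psiList χ L v ∈ D.highest (shiftList χ L) := by
  induction L with
  | nil => exact hv
  | cons b L ih => exact D.psi_mem_highest ih b

theorem Lowered.mem_weightSpace {D : OperatorSystem n V} {χ ψ : Fin (n + 1) → ℂ} {v y : V}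
    (hv : v ∈ D.highest χ) (h : D.Lowered χ v ψ y) : y ∈ D.weightSpace ψ := by
  induction h with
  | base L => exact (D.mem_highest.mp (D.psiList_mem_highest hv L)).1
  | step _ _ ih => exact D.e_mem_weightSpace ih _ _

theorem Lowered.e_mem_loweredSpan {D : OperatorSystem n V} {χ ψ : Fin (n + 1) → ℂ} {v y : V}
    (hv : v ∈ D.highest χ) (h : D.Lowered χ v ψ y) (i j : Fin (n + 1)) :
    D.e i j y ∈ D.loweredSpan χ v := by
  induction h generalizing i j with
  | base L =>
    have hL := D.mem_highest.mp (D.psiList_mem_highest hv L)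
    rcases lt_trichotomy i j with hij | rfl | hij
    · rw [hL.2 i j hij]; exact Submodule.zero_mem _
    · rw [D.mem_weightSpace.mp hL.1]
      exact Submodule.smul_mem _ _ (Lowered.base L).mem
    · exact D.e_mem_loweredSpan_of_lt hij (Lowered.base L).mem
  | step hab hy ih =>
    rw [D.e_e]
    refine Submodule.sub_mem _ (Submodule.add_mem _
      (D.e_mem_loweredSpan_of_lt hab (ih i j)) ?_) ?_
    · split_ifs
      · exact ih _ _
      · exact Submodule.zero_mem _
    · split_ifs
      · exact ih _ _
      · exact Submodule.zero_mem _

theorem isStable_loweredSpan {χ : Fin (n + 1) → ℂ} {v : V} (hv : v ∈ D.highest χ) :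
    D.IsStable (D.loweredSpan χ v) := by
  constructor
  · intro i j x hx
    have : D.loweredSpan χ v ≤ (D.loweredSpan χ v).comap (D.e i j) :=
      Submodule.span_le.mpr fun y ⟨ψ, hy⟩ => hy.e_mem_loweredSpan hv i j
    exact this hx
  · intro k x hx
    have : D.loweredSpan χ v ≤ (D.loweredSpan χ v).comap (D.p k) :=
      Submodule.span_le.mpr fun y ⟨ψ, hy⟩ => hy.p_mem_loweredSpan k
    exact this hx

theorem generated_le_loweredSpan {χ : Fin (n + 1) → ℂ} {v : V} (hv : v ∈ D.highest χ) :
    D.generated v ≤ D.loweredSpan χ v :=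
  D.generated_le (D.isStable_loweredSpan hv) (Lowered.base []).mem

/-- The highest weight vectors in the submodule generated by a highest weight vector `v` are
linear combinations of the vectors `psiList χ L v`. -/
theorem mem_span_psiList {χ ψ : Fin (n + 1) → ℂ} {v x : V} (hv : v ∈ D.highest χ)
    (hx : x ∈ D.highest ψ) (hxv : x ∈ D.generated v) :
    x ∈ Submodule.span ℂ {y | ∃ L, shiftList χ L = ψ ∧ y = D.psiList χ L v} := by
  have h1 := D.mem_span_of_mem_weightSpace
    (S := {y | ∃ ψ, D.Lowered χ v ψ y}) (fun s ⟨ψ, hs⟩ => ⟨ψ, hs.mem_weightSpace hv⟩) (D.mem_highest.mp hx).1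
    (D.generated_le_loweredSpan hv hxv)
  set B := Submodule.span ℂ {y | ∃ L, shiftList χ L = ψ ∧ y = D.psiList χ L v}
  -- A lowered vector either is a word applied to `v` or lies in `lower`; the `lower` part of `x` is
  -- again a highest weight vector, so it vanishes.
  have h2 : x ∈ B ⊔ D.lower := by
    refine Submodule.span_le.mpr ?_ h1
    rintro y ⟨⟨ψ', hy⟩, hyw⟩
    cases hy with
    | base L =>
      by_cases h0 : D.psiList χ L v = 0
      · rw [h0]; exact Submodule.zero_mem _
      refine Submodule.mem_sup_left (Submodule.subset_span ⟨L, ?_, rfl⟩)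
      have h3 := D.mem_weightSpace.mp (D.mem_highest.mp (D.psiList_mem_highest hv L)).1
      have h4 := D.mem_weightSpace.mp hyw
      funext i
      exact smul_left_injective ℂ h0 ((h3 i).symm.trans (h4 i))
    | step hab hy =>
      exact Submodule.mem_sup_right (D.e_mem_lower (hy.mem_weightSpace hv) hab)
  obtain ⟨y, hy, z, hz, rfl⟩ := Submodule.mem_sup.mp h2
  have hy' : y ∈ D.highest ψ := by
    refine Submodule.span_le.mpr ?_ hy
    rintro _ ⟨L, rfl, rfl⟩
    exact D.psiList_mem_highest hv L
  have hz' : z ∈ D.highest ψ := by simpa using Submodule.sub_mem _ hx hy'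
  rw [D.eq_zero_of_mem_highest_of_mem_lower hz' hz, add_zero]
  exact hy

theorem psiList_perm {χ : Fin (n + 1) → ℂ} {z : V} (hz : z ∈ D.highest χ)
    {L L' : List (Fin (n + 1))} (h : L.Perm L') :
    ∃ κ : ℂ, κ ≠ 0 ∧ D.psiList χ L z = κ • D.psiList χ L' z := by
  induction h with
  | nil => exact ⟨1, one_ne_zero, by simp⟩
  | cons b h ih =>
    obtain ⟨κ, hκ, hκ'⟩ := ih
    refine ⟨κ, hκ, ?_⟩
    simp only [psiList, Module.End.mul_apply, hκ', map_smul, shiftList_perm χ h]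
  | swap b c L => exact D.psi_psi (D.psiList_mem_highest hz L) b c
  | trans _ _ ih₁ ih₂ =>
    obtain ⟨κ₁, h₁, h₁'⟩ := ih₁
    obtain ⟨κ₂, h₂, h₂'⟩ := ih₂
    exact ⟨κ₁ * κ₂, mul_ne_zero h₁ h₂, by rw [h₁', h₂', smul_smul]⟩

end Stable

end OperatorSystem

/-! ### Words with the same weight shift -/

/-- The list in which every index occurs exactly `m` times. -/
def fullList (n m : ℕ) : List (Fin (n + 1)) := (List.replicate m (List.finRange (n + 1))).flatten

theorem count_fullList (n m : ℕ) (i : Fin (n + 1)) : (fullList n m).count i = m := by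
  simp [fullList, List.count_flatten, List.count_eq_one_of_mem (List.nodup_finRange _)]

theorem length_fullList (n m : ℕ) : (fullList n m).length = m * (n + 1) := by
  simp [fullList]

theorem fullList_succ (n m : ℕ) : fullList n (m + 1) = fullList n 1 ++ fullList n m := by
  simp [fullList, List.replicate_succ]

theorem shiftList_fullList {n : ℕ} (χ : Fin (n + 1) → ℂ) (m : ℕ) :
    shiftList χ (fullList n m) = χ := by
  funext i
  rw [shiftList_apply, count_fullList, length_fullList]
  have : (n : ℂ) + 1 ≠ 0 := Nat.cast_add_one_ne_zero n
  push_cast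
  field_simp
  ring

/-- Equality of shifts forces `n + 1` times the difference of the counts of each index to be the
difference of lengths, so all counts differ by the same number. -/
theorem perm_of_shiftList_eq {n : ℕ} {χ : Fin (n + 1) → ℂ} {L L' : List (Fin (n + 1))}
    (h : shiftList χ L = shiftList χ L') (hle : L'.length ≤ L.length) :
    ∃ m, L.Perm (fullList n m ++ L') := by
  have h0 : (n : ℂ) + 1 ≠ 0 := Nat.cast_add_one_ne_zero n
  have key : ∀ i, ((n : ℤ) + 1) * ((L.count i : ℤ) - L'.count i) =
      (L.length : ℤ) - L'.length := by
    intro i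
    have h1 := congrFun h i
    rw [shiftList_apply, shiftList_apply] at h1
    have h2 : ((n : ℂ) + 1) * ((L.count i : ℂ) - L'.count i) = (L.length : ℂ) - L'.length := by
      field_simp at h1
      linear_combination h1
    exact_mod_cast h2
  have hpos : (0 : ℤ) < (n : ℤ) + 1 := by positivity
  have hge : ∀ i, L'.count i ≤ L.count i := by
    intro i
    by_contra hlt
    have h1 : (L.count i : ℤ) - L'.count i < 0 := by omega
    have h2 := mul_neg_of_pos_of_neg hpos h1
    rw [key i] at h2
    omega
  refine ⟨L.count 0 - L'.count 0, List.perm_iff_count.mpr fun i => ?_⟩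
  rw [List.count_append, count_fullList]
  have h1 : (L.count i : ℤ) - L'.count i = (L.count 0 : ℤ) - L'.count 0 :=
    mul_left_cancel₀ hpos.ne' ((key i).trans (key 0).symm)
  have h2 := hge i
  have h3 := hge 0
  omega

theorem exists_shortest {n : ℕ} {χ ψ : Fin (n + 1) → ℂ} (h : ∃ L, shiftList χ L = ψ) :
    ∃ L₀, shiftList χ L₀ = ψ ∧ ∀ L, shiftList χ L = ψ → ∃ m, L.Perm (fullList n m ++ L₀) := by
  obtain ⟨L₀, h₀, hmin⟩ := (measure (List.length (α := Fin (n + 1)))).wf.has_min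
    {L | shiftList χ L = ψ} h
  refine ⟨L₀, h₀, fun L hL => perm_of_shiftList_eq (hL.trans h₀.symm) ?_⟩
  exact not_lt.mp (hmin L hL)

/-! ### Polynomials in the full word -/

open Polynomial

theorem map_aeval_apply {V V' : Type*} [AddCommGroup V] [Module ℂ V] [AddCommGroup V']
    [Module ℂ V'] {A : Module.End ℂ V} {A' : Module.End ℂ V'} {f : V →ₗ[ℂ] V'}
    (h : ∀ x, f (A x) = A' (f x)) (q : ℂ[X]) (x : V) : f (aeval A q x) = aeval A' q (f x) := by
  have hpow : ∀ (k : ℕ) (x : V), f ((A ^ k) x) = (A' ^ k) (f x) := by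
    intro k
    induction k with
    | zero => simp
    | succ k ih => intro x; rw [pow_succ, pow_succ, Module.End.mul_apply, ih, h]; rfl
  induction q using Polynomial.induction_on' with
  | add q r hq hr => simp only [map_add, LinearMap.add_apply, hq, hr]
  | monomial k a =>
    simp only [aeval_monomial, Module.End.mul_apply, Module.algebraMap_end_apply, map_smul, hpow]

namespace OperatorSystem

variable {n : ℕ} {V : Type*} [AddCommGroup V] [Module ℂ V] (D : OperatorSystem n V)

theorem psiList_fullList (χ : Fin (n + 1) → ℂ) (m : ℕ) :
    D.psiList χ (fullList n m) = D.psiList χ (fullList n 1) ^ m := by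
  induction m with
  | zero => simp [fullList, psiList]
  | succ m ih => rw [fullList_succ, psiList_append, shiftList_fullList, ih, pow_succ']

/-- The operator system on a product. -/
def prod : OperatorSystem n (V × V) where
  e i j := (D.e i j).prodMap (D.e i j)
  p k := (D.p k).prodMap (D.p k)
  e_e i j k l x := by
    refine Prod.ext ?_ ?_
    · have := D.e_e i j k l x.1
      split_ifs at this ⊢ <;> simpa using this
    · have := D.e_e i j k l x.2
      split_ifs at this ⊢ <;> simpa using this
  e_p i j k x := by
    refine Prod.ext ?_ ?_
    · have := D.e_p i j k x.1
      split_ifs at this ⊢ <;> simpa using this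
    · have := D.e_p i j k x.2
      split_ifs at this ⊢ <;> simpa using this
  p_p i j x := Prod.ext (D.p_p i j x.1) (D.p_p i j x.2)

theorem mem_highest_prod {χ : Fin (n + 1) → ℂ} {x : V × V} :
    x ∈ D.prod.highest χ ↔ x.1 ∈ D.highest χ ∧ x.2 ∈ D.highest χ := by
  simp only [mem_highest, mem_weightSpace, prod, LinearMap.prodMap_apply, Prod.ext_iff,
    Prod.smul_fst, Prod.smul_snd, Prod.fst_zero, Prod.snd_zero]
  constructor
  · rintro ⟨h1, h2⟩
    exact ⟨⟨fun i => (h1 i).1, fun a b h => (h2 a b h).1⟩,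
      ⟨fun i => (h1 i).2, fun a b h => (h2 a b h).2⟩⟩
  · rintro ⟨⟨h1, h2⟩, h3, h4⟩
    exact ⟨fun i => ⟨h1 i, h3 i⟩, fun a b h => ⟨h2 a b h, h4 a b h⟩⟩

variable [FiniteDimensional ℂ V]

theorem exists_weight_vector {K : Submodule ℂ V} (hK : ∀ i, ∀ x ∈ K, D.e i i x ∈ K)
    (h0 : K ≠ ⊥) : ∃ χ, ∃ x ∈ D.weightSpace χ, x ∈ K ∧ x ≠ 0 := by
  have hcomm : ∀ i j x, D.e i i (D.e j j x) = D.e j j (D.e i i x) := by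
    intro i j x
    rw [D.e_e]
    rcases eq_or_ne i j with rfl | hij
    · simp
    · simp [hij, hij.symm]
  have key : ∀ s : Finset (Fin (n + 1)), ∃ χ : Fin (n + 1) → ℂ,
      ∃ x ∈ K, x ≠ 0 ∧ ∀ i ∈ s, D.e i i x = χ i • x := by
    intro s
    induction s using Finset.induction_on with
    | empty =>
      obtain ⟨x, hx, hx0⟩ := Submodule.exists_mem_ne_zero_of_ne_bot h0
      exact ⟨0, x, hx, hx0, by simp⟩
    | insert j s hj ih =>
      obtain ⟨χ, x, hx, hx0, hχ⟩ := ih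
      let M : Submodule ℂ V := K ⊓ ⨅ i ∈ s, Module.End.eigenspace (D.e i i) (χ i)
      have hM : ∀ y, y ∈ M ↔ y ∈ K ∧ ∀ i ∈ s, D.e i i y = χ i • y := by
        intro y
        simp [M]
      have hMj : ∀ y ∈ M, D.e j j y ∈ M := by
        intro y hy
        rw [hM] at hy ⊢
        refine ⟨hK j y hy.1, fun i hi => ?_⟩
        rw [hcomm, hy.2 i hi, map_smul]
      have : Nontrivial M :=
        ⟨⟨x, (hM x).mpr ⟨hx, hχ⟩⟩, 0, fun h => hx0 (congrArg Subtype.val h)⟩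
      obtain ⟨c, hc⟩ := Module.End.exists_eigenvalue ((D.e j j).restrict hMj)
      obtain ⟨⟨y, hy⟩, hyc, hy0⟩ := hc.exists_hasEigenvector
      have hyc' := congrArg Subtype.val (Module.End.mem_eigenspace_iff.mp hyc)
      rw [hM] at hy
      refine ⟨Function.update χ j c, y, hy.1, fun h => hy0 (Subtype.ext h), fun i hi => ?_⟩
      rcases eq_or_ne i j with rfl | hij
      · simpa using hyc'
      · rw [Function.update_of_ne hij]
        exact hy.2 i (Finset.mem_of_mem_insert_of_ne hi hij)
  obtain ⟨χ, x, hx, hx0, h⟩ := key Finset.univ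
  exact ⟨χ, x, D.mem_weightSpace.mpr fun i => h i (Finset.mem_univ i), hx, hx0⟩

/-- The highest weight vectors of one weight in the submodule generated by a highest weight
vector form a cyclic module over the polynomials in one operator. -/
theorem exists_aeval {χ ψ : Fin (n + 1) → ℂ} {v x : V} (hv : v ∈ D.highest χ)
    {L₀ : List (Fin (n + 1))}
    (hL₀ : ∀ L, shiftList χ L = ψ → ∃ m, L.Perm (fullList n m ++ L₀)) (h₀ : shiftList χ L₀ = ψ)
    (hx : x ∈ D.highest ψ) (hxv : x ∈ D.generated v) :
    ∃ q : ℂ[X], x = aeval (D.psiList ψ (fullList n 1)) q (D.psiList χ L₀ v) := by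
  let ev : ℂ[X] →ₗ[ℂ] V := (LinearMap.applyₗ (D.psiList χ L₀ v)).comp
    (aeval (R := ℂ) (D.psiList ψ (fullList n 1))).toLinearMap
  suffices h : x ∈ LinearMap.range ev by
    obtain ⟨q, hq⟩ := h
    exact ⟨q, hq.symm⟩
  refine Submodule.span_le.mpr ?_ (D.mem_span_psiList hv hx hxv)
  rintro _ ⟨L, hL, rfl⟩
  -- Up to a scalar, the word `L` is `L₀` followed by the `m`-th power of the full word.
  obtain ⟨m, hm⟩ := hL₀ L hL
  obtain ⟨κ, -, hκ⟩ := D.psiList_perm hv hm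
  refine ⟨monomial m κ, ?_⟩
  rw [hκ, psiList_append, h₀, psiList_fullList]
  simp [ev, aeval_monomial]

/-- Adding `ε_n` too often destroys dominance, so a high power of the last `psi` kills `x`. A power
of the full word contains these letters, and they can be moved to act first. -/
theorem exists_pow_apply_eq_zero (hn : 1 ≤ n) {χ : Fin (n + 1) → ℂ} {x : V}
    (hx : x ∈ D.highest χ) : ∃ m : ℕ, (D.psiList χ (fullList n 1) ^ m) x = 0 := by
  rcases eq_or_ne x 0 with rfl | h0
  · exact ⟨0, map_zero _⟩
  -- The last but one index, distinct from the last since `n ≥ 1`.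
  let a : Fin (n + 1) := ⟨n - 1, by omega⟩
  have hab : a < Fin.last n := Fin.lt_def.mpr (by simp only [a, Fin.val_last]; omega)
  obtain ⟨d, hd⟩ := D.dominant_of_mem_highest hx h0 a (Fin.last n) hab
  have hzero : D.psiList χ (List.replicate (d + 1) (Fin.last n)) x = 0 := by
    by_contra hne
    obtain ⟨m, hm⟩ := D.dominant_of_mem_highest (D.psiList_mem_highest hx _) hne a (Fin.last n) hab
    rw [shiftList_apply, shiftList_apply, List.count_replicate_self, List.count_replicate,
      if_neg (by simpa using hab.ne')] at hm
    have h1 : ((m + 1 : ℕ) : ℂ) = 0 := by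
      push_cast at hm ⊢
      linear_combination hd - hm
    exact absurd h1 (Nat.cast_ne_zero.mpr (by omega))
  have hsub : (List.replicate (d + 1) (Fin.last n)).Sublist (fullList n (d + 1)) :=
    List.replicate_sublist_iff.mpr (count_fullList n (d + 1) _).ge
  obtain ⟨L, hL⟩ := hsub.exists_perm_append
  obtain ⟨κ, -, hκ⟩ := D.psiList_perm hx (hL.trans List.perm_append_comm)
  refine ⟨d + 1, ?_⟩
  rw [← psiList_fullList, hκ, psiList_append, Module.End.mul_apply, hzero, map_zero, smul_zero]

/-- Two highest weight vectors which generate each other have the same weight. -/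
theorem weight_eq_of_generated (hn : 1 ≤ n) {χ ψ : Fin (n + 1) → ℂ} {v w : V}
    (hv : v ∈ D.highest χ) (hw : w ∈ D.highest ψ) (hv0 : v ≠ 0) (hwv : w ∈ D.generated v)
    (hvw : v ∈ D.generated w) : χ = ψ := by
  by_contra hne
  set A := D.psiList χ (fullList n 1)
  -- The range consists of the vectors `A q(A) v`. A word from `v` to `w` followed by one back is a
  -- power of `A` up to a scalar, of positive exponent because the weights differ.
  let ev : ℂ[X] →ₗ[ℂ] V := (LinearMap.applyₗ v).comp
    ((aeval (R := ℂ) A).toLinearMap.comp (LinearMap.mulLeft ℂ X))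
  have hev : ∀ q, ev q = aeval A (X * q) v := fun q => rfl
  have hmem : v ∈ LinearMap.range ev := by
    refine Submodule.span_le.mpr ?_ (D.mem_span_psiList hw hv hvw)
    rintro _ ⟨L', hL', rfl⟩
    have hle : Submodule.span ℂ {y | ∃ L, shiftList χ L = ψ ∧ y = D.psiList χ L v} ≤
        (LinearMap.range ev).comap (D.psiList ψ L') := by
      refine Submodule.span_le.mpr ?_
      rintro _ ⟨L, hL, rfl⟩
      obtain ⟨m, hm⟩ := perm_of_shiftList_eq (χ := χ) (L := L' ++ L) (L' := [])
        (by rw [shiftList_append, hL, hL']; rfl) (by simp)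
      rw [List.append_nil] at hm
      obtain ⟨κ, -, hκ⟩ := D.psiList_perm hv hm
      rw [psiList_append, hL, psiList_fullList] at hκ
      cases m with
      | zero =>
        exfalso
        have : L = [] := (List.append_eq_nil_iff.mp (List.perm_nil.mp hm)).2
        exact hne (by rw [← hL, this]; rfl)
      | succ m =>
        refine ⟨monomial m κ, ?_⟩
        rw [← Module.End.mul_apply, hκ, hev, X_mul_monomial, aeval_monomial]
        rfl
    exact hle (D.mem_span_psiList hv hw hwv)
  obtain ⟨q, hq⟩ := hmem
  obtain ⟨m, hm⟩ := D.exists_pow_apply_eq_zero hn hv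
  rw [hev] at hq
  have hpow : ∀ k : ℕ, aeval A ((X * q) ^ k) v = v := by
    intro k
    induction k with
    | zero => simp
    | succ k ih => rw [pow_succ, map_mul, Module.End.mul_apply, hq, ih]
  refine hv0 ?_
  rw [← hpow m, mul_pow, mul_comm, map_mul, Module.End.mul_apply, map_pow, map_pow, aeval_X, hm,
    map_zero]

/-- If `w` is in the submodule generated by `v`, and both are highest weight vectors of the same
weight, then the annihilator of `v` annihilates `w`. -/
theorem eq_zero_of_mem_generated_prod {χ : Fin (n + 1) → ℂ} {v w y : V}
    (hv : v ∈ D.highest χ) (hw : w ∈ D.highest χ) (hwv : w ∈ D.generated v)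
    (hy : ((0 : V), y) ∈ D.prod.generated (v, w)) : y = 0 := by
  by_contra hy0
  have hst := D.prod.isStable_generated (v, w)
  have hKst : ∀ a b, ∀ x ∈ D.prod.generated (v, w) ⊓ LinearMap.ker (LinearMap.fst ℂ V V),
      D.prod.e a b x ∈ D.prod.generated (v, w) ⊓ LinearMap.ker (LinearMap.fst ℂ V V) := by
    rintro a b x ⟨hx1, hx2⟩
    refine ⟨hst.1 a b x hx1, ?_⟩
    rw [SetLike.mem_coe, LinearMap.mem_ker, LinearMap.fst_apply] at hx2 ⊢
    change D.e a b x.1 = 0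
    rw [hx2, map_zero]
  obtain ⟨ψ', x, hx, hxK, hx0⟩ := D.prod.exists_weight_vector (fun i => hKst i i)
    ((Submodule.ne_bot_iff _).mpr ⟨(0, y), ⟨hy, rfl⟩, fun h => hy0 (congrArg Prod.snd h)⟩)
  obtain ⟨ψ, -, u, hu, ⟨huG, huK⟩, hu0⟩ := D.prod.exists_mem_highest hKst hx hxK hx0
  have hz : (v, w) ∈ D.prod.highest χ := D.mem_highest_prod.mpr ⟨hv, hw⟩
  have hex : ∃ L, shiftList χ L = ψ := by
    by_contra hno
    refine hu0 ?_
    have := D.prod.mem_span_psiList hz hu huG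
    rwa [show {y | ∃ L, shiftList χ L = ψ ∧ y = D.prod.psiList χ L (v, w)} = ∅ from
      Set.eq_empty_of_forall_notMem fun y ⟨L, hL, _⟩ => hno ⟨L, hL⟩, Submodule.span_empty,
      Submodule.mem_bot] at this
  obtain ⟨L₀, h₀, hL₀⟩ := exists_shortest hex
  obtain ⟨q, hq⟩ := D.prod.exists_aeval hz hL₀ h₀ hu huG
  -- Since `w` lies in the submodule generated by `v`, so does the word `L₀` applied to `w`, which
  -- is thus a polynomial in the full word applied to `psiList χ L₀ v`.
  obtain ⟨r, hr⟩ := D.exists_aeval hv hL₀ h₀ (h₀ ▸ D.psiList_mem_highest hw L₀)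
    ((D.isStable_generated v).psiList_mem χ L₀ hwv)
  have hfst : ∀ χ L x, LinearMap.fst ℂ V V (D.prod.psiList χ L x) = D.psiList χ L x.1 :=
    fun χ L x => map_psiList (D := D.prod) (D' := D) (f := LinearMap.fst ℂ V V)
      (fun _ _ _ => rfl) (fun _ _ => rfl) χ L x
  have hsnd : ∀ χ L x, LinearMap.snd ℂ V V (D.prod.psiList χ L x) = D.psiList χ L x.2 :=
    fun χ L x => map_psiList (D := D.prod) (D' := D) (f := LinearMap.snd ℂ V V)
      (fun _ _ _ => rfl) (fun _ _ => rfl) χ L x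
  have h1 : aeval (D.psiList ψ (fullList n 1)) q (D.psiList χ L₀ v) = 0 := by
    have := congrArg (LinearMap.fst ℂ V V) hq
    rw [map_aeval_apply (fun x => hfst ψ (fullList n 1) x), hfst] at this
    exact this.symm.trans huK
  have h2 : u.2 = aeval (D.psiList ψ (fullList n 1)) q (D.psiList χ L₀ w) := by
    have := congrArg (LinearMap.snd ℂ V V) hq
    rwa [map_aeval_apply (fun x => hsnd ψ (fullList n 1) x), hsnd] at this
  refine hu0 (Prod.ext huK ?_)
  rw [h2, hr, ← Module.End.mul_apply, ← map_mul, mul_comm, map_mul, Module.End.mul_apply, h1,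
    map_zero]
  rfl

end OperatorSystem

/-! ### Matrix units and basis vectors in the semidirect sum -/

/-- The traceless part of a matrix unit. -/
def tracelessUnit {n : ℕ} (i j : Fin (n + 1)) : SL n :=
  ⟨Matrix.single i j 1 - (if i = j then ((n : ℂ) + 1)⁻¹ else 0) • 1, by
    have h0 : (n : ℂ) + 1 ≠ 0 := Nat.cast_add_one_ne_zero n
    refine LinearMap.mem_ker.mpr ?_
    rw [Matrix.traceLinearMap_apply, Matrix.trace_sub, Matrix.trace_smul, Matrix.trace_one]
    rcases eq_or_ne i j with rfl | h
    · simp [h0]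
    · simp [h, Matrix.trace_single_eq_of_ne _ _ _ h]⟩

theorem val_tracelessUnit {n : ℕ} (i j : Fin (n + 1)) : (tracelessUnit i j).val =
    Matrix.single i j 1 - (if i = j then ((n : ℂ) + 1)⁻¹ else 0) • 1 := rfl

theorem lie_tracelessUnit {n : ℕ} (i j k l : Fin (n + 1)) :
    ⁅tracelessUnit i j, tracelessUnit k l⁆ =
      (if j = k then tracelessUnit i l else 0) - (if l = i then tracelessUnit k j else 0) := by
  have key : ∀ (A B : Matrix (Fin (n + 1)) (Fin (n + 1)) ℂ) (c d : ℂ),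
      (A - c • 1) * (B - d • 1) - (B - d • 1) * (A - c • 1) = A * B - B * A := by
    intro A B c d
    simp only [mul_sub, sub_mul, Matrix.smul_mul, Matrix.mul_smul, one_mul, mul_one]
    rw [smul_comm c d]
    abel
  apply Subtype.ext
  rw [LieAlgebra.SpecialLinear.sl_bracket, val_tracelessUnit, val_tracelessUnit, key]
  by_cases h1 : j = k <;> by_cases h2 : l = i
  · subst h1 h2
    simp [val_tracelessUnit]
  · subst h1
    simp [val_tracelessUnit, h2, Ne.symm h2, Matrix.single_mul_single_of_ne]
  · subst h2
    simp [val_tracelessUnit, h1, Ne.symm h1, Matrix.single_mul_single_of_ne]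
  · simp [h1, h2, Matrix.single_mul_single_of_ne]

theorem rootVector_eq {n : ℕ} {i j : Fin (n + 1)} (h : i ≠ j) :
    rootVector i j h = ofSL (tracelessUnit i j) := by
  rw [rootVector]
  congr 1
  apply Subtype.ext
  rw [LieAlgebra.SpecialLinear.val_single, val_tracelessUnit, if_neg h, zero_smul, sub_zero]

theorem coroot_eq {n : ℕ} (i : Fin n) :
    (coroot i : G n) = ofSL (tracelessUnit i.castSucc i.castSucc - tracelessUnit i.succ i.succ) := by
  rw [coroot]
  congr 1
  apply Subtype.ext
  rw [LieAlgebra.SpecialLinear.val_singleSubSingle]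
  simp [val_tracelessUnit]

theorem sum_tracelessUnit (n : ℕ) : ∑ i : Fin (n + 1), tracelessUnit i i = 0 := by
  apply Subtype.ext
  have h0 : (n : ℂ) + 1 ≠ 0 := Nat.cast_add_one_ne_zero n
  rw [AddSubmonoidClass.coe_finsetSum]
  simp only [val_tracelessUnit, if_true, Finset.sum_sub_distrib, Matrix.sum_single_one,
    Finset.sum_const, Finset.card_univ, Fintype.card_fin]
  rw [← Nat.cast_smul_eq_nsmul ℂ, smul_smul]
  push_cast
  rw [mul_inv_cancel₀ h0, one_smul, sub_self]

/-- The scalar corrections add up to a multiple of the trace of `X`, which is zero. -/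
theorem eq_sum_tracelessUnit {n : ℕ} (X : SL n) :
    X = ∑ i, ∑ j, X.val i j • tracelessUnit i j := by
  apply Subtype.ext
  have htr : ∑ i, X.val i i = 0 := by
    have := LinearMap.mem_ker.mp X.2
    exact this
  simp only [AddSubmonoidClass.coe_finsetSum]
  have h1 : ∀ i j, (X.val i j • tracelessUnit i j : SL n).val = Matrix.single i j (X.val i j) -
      (if i = j then X.val i j * ((n : ℂ) + 1)⁻¹ else 0) • 1 := by
    intro i j
    change X.val i j • (tracelessUnit i j).val = _
    rw [val_tracelessUnit, smul_sub, Matrix.smul_single, smul_smul, smul_eq_mul, mul_one, mul_ite,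
      mul_zero]
  simp only [h1, Finset.sum_sub_distrib, ← Finset.sum_smul, Finset.sum_ite_eq, Finset.mem_univ,
    if_true, ← Finset.sum_mul, htr, zero_mul, zero_smul, sub_zero]
  exact Matrix.matrix_eq_sum_single X.val

theorem lie_ofSL_ofSL {n : ℕ} (X Y : SL n) : ⁅ofSL X, ofSL Y⁆ = ofSL ⁅X, Y⁆ :=
  (LieHom.map_lie (LieAlgebra.SemiDirectSum.inr (stdAction n)) X Y).symm

theorem lie_ofSL_ofStd {n : ℕ} (X : SL n) (x : Std n) :
    ⁅ofSL X, ofStd x⁆ = ofStd (mulStd X.val x) := by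
  simp only [ofSL, ofStd, LieAlgebra.SemiDirectSum.inr_eq_mk, LieAlgebra.SemiDirectSum.inl_eq_mk,
    LieAlgebra.SemiDirectSum.lie_eq_mk]
  simp
  rfl

/-- The standard basis vectors of `ℂ^{n+1}`. -/
def basisVector {n : ℕ} (i : Fin (n + 1)) : Std n := (Pi.single i 1 : Fin (n + 1) → ℂ)

/-- `ofStd` as a linear map. -/
def ofStdLinear (n : ℕ) : Std n →ₗ[ℂ] G n := LieAlgebra.SemiDirectSum.inl (stdAction n)

theorem ofStdLinear_apply {n : ℕ} (x : Std n) : ofStdLinear n x = ofStd x := rfl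

theorem ofStd_basisVector {n : ℕ} (i : Fin (n + 1)) : ofStd (basisVector i) = P i := rfl

theorem mulStd_tracelessUnit {n : ℕ} (i j k : Fin (n + 1)) :
    mulStd (tracelessUnit i j).val (basisVector k) =
      (if j = k then basisVector i else 0) -
        (if i = j then ((n : ℂ) + 1)⁻¹ • basisVector k else 0) := by
  have h : (tracelessUnit i j).val.mulVec (Pi.single k 1 : Fin (n + 1) → ℂ) =
      ((if j = k then (Pi.single i 1 : Fin (n + 1) → ℂ) else 0) -
        (if i = j then ((n : ℂ) + 1)⁻¹ • (Pi.single k 1 : Fin (n + 1) → ℂ) else 0) :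
        Fin (n + 1) → ℂ) := by
    rw [val_tracelessUnit, Matrix.sub_mulVec, Matrix.smul_mulVec, Matrix.one_mulVec]
    congr 1
    · rw [Matrix.single_mulVec]
      by_cases h : j = k
      · subst h
        simp
        rfl
      · simp [h]
    · split_ifs <;> simp
  exact h

theorem lie_tracelessUnit_P {n : ℕ} (i j k : Fin (n + 1)) :
    ⁅ofSL (tracelessUnit i j), P k⁆ =
      (if j = k then P i else 0) - (if i = j then ((n : ℂ) + 1)⁻¹ • P k else 0) := by
  rw [← ofStd_basisVector, lie_ofSL_ofStd, mulStd_tracelessUnit, ← ofStdLinear_apply, map_sub,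
    apply_ite (ofStdLinear n), apply_ite (ofStdLinear n), map_zero, map_smul]
  rfl

theorem lie_P_P {n : ℕ} (i j : Fin (n + 1)) : ⁅(P i : G n), P j⁆ = 0 := by
  have h := LieHom.map_lie (LieAlgebra.SemiDirectSum.inl (stdAction n)) (basisVector i)
    (basisVector j)
  rw [std_lie, map_zero] at h
  exact h.symm

theorem eq_sum_P {n : ℕ} (x : Std n) :
    ofStd x = ∑ k, (x : Fin (n + 1) → ℂ) k • (P k : G n) := by
  have h : x = ∑ k, (x : Fin (n + 1) → ℂ) k • basisVector k := by
    have h1 : (x : Fin (n + 1) → ℂ) = ∑ k, (x : Fin (n + 1) → ℂ) k •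
        (Pi.single k 1 : Fin (n + 1) → ℂ) := pi_eq_sum_univ' (x : Fin (n + 1) → ℂ)
    exact h1
  conv_lhs => rw [h]
  rw [← ofStdLinear_apply, map_sum]
  simp only [map_smul, ofStdLinear_apply, ofStd_basisVector]

theorem eq_ofSL_add_ofStd {n : ℕ} (g : G n) : g = ofSL g.right + ofStd g.left := by
  simp [ofSL, ofStd]

/-! ### From modules to operator systems -/

section Module

variable {n : ℕ} {V : Type*} [AddCommGroup V] [Module ℂ V] [LieRingModule (G n) V]
  [LieModule ℂ (G n) V]

variable (n V) in
/-- The operator system of a module over `sl(n+1) ⋉ ℂ^{n+1}`. -/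
def operatorSystem : OperatorSystem n V where
  e i j := LieModule.toEnd ℂ (G n) V (ofSL (tracelessUnit i j))
  p k := LieModule.toEnd ℂ (G n) V (P k)
  e_e i j k l x := by
    simp only [LieModule.toEnd_apply_apply]
    rw [leibniz_lie, lie_ofSL_ofSL, lie_tracelessUnit, add_comm, add_sub_assoc]
    congr 1
    simp only [ofSL, map_sub, sub_lie]
    split_ifs <;> simp only [map_zero, zero_lie]
  e_p i j k x := by
    simp only [LieModule.toEnd_apply_apply]
    rw [leibniz_lie, lie_tracelessUnit_P, add_comm, add_sub_assoc]
    congr 1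
    rw [sub_lie]
    split_ifs <;> simp only [zero_lie, smul_lie]
  p_p i j x := by
    simp only [LieModule.toEnd_apply_apply]
    rw [leibniz_lie, lie_P_P, zero_lie, zero_add]

theorem operatorSystem_e (i j : Fin (n + 1)) (x : V) :
    (operatorSystem n V).e i j x = ⁅ofSL (tracelessUnit i j), x⁆ := rfl

theorem coroot_lie (i : Fin n) (v : V) : ⁅(coroot i : G n), v⁆ =
    (operatorSystem n V).e i.castSucc i.castSucc v - (operatorSystem n V).e i.succ i.succ v := by
  rw [operatorSystem_e, operatorSystem_e, ← sub_lie, coroot_eq]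
  simp only [ofSL, map_sub]

theorem sum_operatorSystem_e (v : V) : ∑ j, (operatorSystem n V).e j j v = 0 := by
  have h : ∑ j, (operatorSystem n V).e j j v =
      ⁅ofSL (∑ j : Fin (n + 1), tracelessUnit j j), v⁆ := by
    simp only [operatorSystem_e, ofSL, map_sum]
    rw [sum_lie]
  rw [h, sum_tracelessUnit, ofSL, map_zero, zero_lie]

theorem IsHighestWeightVector.exists_mem_highest {μ : Weight n} {v : V}
    (hv : IsHighestWeightVector μ v) : ∃ χ, v ∈ (operatorSystem n V).highest χ ∧
      ∀ i : Fin n, (μ i : ℂ) = χ i.castSucc - χ i.succ := by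
  set D := operatorSystem n V
  -- The coroots determine only differences of the diagonal operators; the vanishing of their sum
  -- then fixes the common summand.
  have hc : ∀ j : Fin (n + 1), ∃ c : ℂ, D.e j j v = D.e 0 0 v + c • v := by
    intro j
    induction j using Fin.induction with
    | zero => exact ⟨0, by simp⟩
    | succ i ih =>
      obtain ⟨c, hc⟩ := ih
      refine ⟨c - μ i, ?_⟩
      have h := hv.weight i
      rw [coroot_lie, hc, sub_eq_iff_eq_add] at h
      rw [sub_smul, ← add_sub_assoc, h, add_sub_cancel_left]
  choose c hc using hc
  have h0 : (n : ℂ) + 1 ≠ 0 := Nat.cast_add_one_ne_zero n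
  have hsum : ∑ j, D.e j j v = 0 := sum_operatorSystem_e v
  have h00 : D.e 0 0 v = (-(((n : ℂ) + 1)⁻¹ * ∑ j, c j)) • v := by
    have h1 : ((n : ℂ) + 1) • D.e 0 0 v + (∑ j, c j) • v = 0 := by
      rw [← hsum, Finset.sum_congr rfl fun j _ => hc j, Finset.sum_add_distrib, Finset.sum_smul,
        Finset.sum_const, Finset.card_univ, Fintype.card_fin, ← Nat.cast_smul_eq_nsmul ℂ]
      push_cast
      rfl
    rw [neg_smul, mul_smul, ← smul_neg, ← eq_neg_of_add_eq_zero_left h1, smul_smul,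
      inv_mul_cancel₀ h0, one_smul]
  have hw : v ∈ D.weightSpace fun j => -(((n : ℂ) + 1)⁻¹ * ∑ j, c j) + c j := by
    rw [D.mem_weightSpace]
    intro j
    rw [hc, h00, add_smul]
  refine ⟨_, D.mem_highest.mpr ⟨hw, fun a b hab => ?_⟩, fun i => ?_⟩
  · rw [operatorSystem_e, ← rootVector_eq hab.ne]
    exact hv.raising a b hab
  · refine smul_left_injective ℂ hv.ne_zero ?_
    have h := hv.weight i
    rw [coroot_lie, D.mem_weightSpace.mp hw, D.mem_weightSpace.mp hw, ← sub_smul] at h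
    exact h.symm

theorem act_mul (a b : U n) (x : V) : act (a * b) x = act a (act b x) := by
  simp only [act, map_mul, Module.End.mul_apply]

attribute [local instance] LieRing.ofAssociativeRing in
-- By the universal property, the map from the Lie algebra into `S` extends to the enveloping
-- algebra, and composing with the inclusion gives the identity.
theorem mem_of_forall_ι_mem {S : Subalgebra ℂ (U n)}
    (hS : ∀ g : G n, UniversalEnvelopingAlgebra.ι ℂ g ∈ S) (u : U n) : u ∈ S := by
  let f : G n →ₗ⁅ℂ⁆ S :=
    { toFun := fun g => ⟨UniversalEnvelopingAlgebra.ι ℂ g, hS g⟩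
      map_add' := fun x y => Subtype.ext (map_add (UniversalEnvelopingAlgebra.ι ℂ) x y)
      map_smul' := fun c x => Subtype.ext (map_smul (UniversalEnvelopingAlgebra.ι ℂ) c x)
      map_lie' := fun {x y} => Subtype.ext (LieHom.map_lie (UniversalEnvelopingAlgebra.ι ℂ) x y) }
  have h : S.val.comp (UniversalEnvelopingAlgebra.lift ℂ f) = AlgHom.id ℂ (U n) := by
    apply UniversalEnvelopingAlgebra.hom_ext
    apply LieHom.ext
    intro g
    change S.val (UniversalEnvelopingAlgebra.lift ℂ f (UniversalEnvelopingAlgebra.ι ℂ g)) = _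
    rw [UniversalEnvelopingAlgebra.lift_ι_apply]
    rfl
  have := AlgHom.congr_fun h u
  rw [AlgHom.comp_apply, AlgHom.id_apply] at this
  rw [← this]
  exact (UniversalEnvelopingAlgebra.lift ℂ f u).2

theorem act_mem_of_isStable {W : Submodule ℂ (V × V)} (hW : (operatorSystem n V).prod.IsStable W)
    (u : U n) {x : V × V} (hx : x ∈ W) : (act u x.1, act u x.2) ∈ W := by
  let S : Subalgebra ℂ (U n) :=
    { carrier := {u | ∀ x ∈ W, (act u x.1, act u x.2) ∈ W}
      mul_mem' := fun {a b} ha hb x hx => by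
        rw [act_mul, act_mul]
        exact ha _ (hb x hx)
      add_mem' := fun {a b} ha hb x hx => by
        have := W.add_mem (ha x hx) (hb x hx)
        simpa only [act, map_add, LinearMap.add_apply, Prod.mk_add_mk] using this
      algebraMap_mem' := fun r x hx => by
        have := W.smul_mem r hx
        simp only [act, AlgHom.commutes, Module.algebraMap_end_apply]
        exact this }
  refine mem_of_forall_ι_mem (S := S) (fun g x hx => ?_) u x hx
  let T : G n →ₗ[ℂ] V × V :=
    { toFun := fun g => (⁅g, x.1⁆, ⁅g, x.2⁆)
      map_add' := fun a b => Prod.ext (add_lie a b x.1) (add_lie a b x.2)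
      map_smul' := fun c a => Prod.ext (smul_lie c a x.1) (smul_lie c a x.2) }
  have hT : T g ∈ W := by
    have hr : ofSL g.right = ∑ i, ∑ j, g.right.val i j • (ofSL (tracelessUnit i j) : G n) := by
      conv_lhs => rw [eq_sum_tracelessUnit g.right]
      simp only [ofSL, map_sum, map_smul]
    rw [eq_ofSL_add_ofStd g, hr, eq_sum_P, map_add, map_sum, map_sum]
    refine W.add_mem (W.sum_mem fun i _ => ?_) (W.sum_mem fun k _ => ?_)
    · rw [map_sum]
      refine W.sum_mem fun j _ => ?_
      rw [map_smul]
      exact W.smul_mem _ (hW.1 i j x hx)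
    · rw [map_smul]
      exact W.smul_mem _ (hW.2 k x hx)
  simp only [act, UniversalEnvelopingAlgebra.lift_ι_apply, LieModule.toEnd_apply_apply]
  exact hT

theorem Generates.mem_generated {v : V} (hv : Generates n v) (x : V) :
    x ∈ (operatorSystem n V).generated v := by
  obtain ⟨u, rfl⟩ := hv x
  set D := operatorSystem n V
  have hst := D.isStable_generated v
  have : D.prod.IsStable ((D.generated v).comap (LinearMap.fst ℂ V V)) :=
    ⟨fun i j x hx => hst.1 i j x.1 hx, fun k x hx => hst.2 k x.1 hx⟩
  exact act_mem_of_isStable this u (x := (v, v)) (D.mem_generated_self v)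

theorem weight_eq_of_generates [FiniteDimensional ℂ V] (hn : 1 ≤ n) {μ ν : Weight n} {v w : V}
    (hv : IsHighestWeightVector μ v) (hw : IsHighestWeightVector ν w) (hvgen : Generates n v)
    (hwgen : Generates n w) : μ = ν := by
  obtain ⟨χ, hχ, hμ⟩ := hv.exists_mem_highest
  obtain ⟨ψ, hψ, hν⟩ := hw.exists_mem_highest
  have := (operatorSystem n V).weight_eq_of_generated hn hχ hψ hv.ne_zero
    (hvgen.mem_generated w) (hwgen.mem_generated v)
  funext i
  have h : (μ i : ℂ) = ν i := by rw [hμ, hν, this]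
  exact_mod_cast h

/-- If `u` kills `v`, then `(0, u w)` lies in the submodule of `V × V` generated by `(v, w)`. -/
theorem act_eq_zero_of_act_eq_zero [FiniteDimensional ℂ V] {μ : Weight n} {v w : V}
    (hv : IsHighestWeightVector μ v) (hw : IsHighestWeightVector μ w) (hvgen : Generates n v)
    {u : U n} (hu : act u v = 0) : act u w = 0 := by
  obtain ⟨χ, hχ, hμ⟩ := hv.exists_mem_highest
  obtain ⟨ψ, hψ, hν⟩ := hw.exists_mem_highest
  set D := operatorSystem n V
  -- Both weights have the same consecutive differences `μ i` and coordinate sum zero.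
  have hχψ : χ = ψ := by
    have hd : ∀ i, χ i - ψ i = χ 0 - ψ 0 := by
      intro i
      induction i using Fin.induction with
      | zero => rfl
      | succ i ih => linear_combination ih + hμ i - hν i
    have hs : ∀ {χ : Fin (n + 1) → ℂ} {v : V}, v ≠ 0 → v ∈ D.highest χ → ∑ i, χ i = 0 := by
      intro χ v hv0 hv
      have h1 : ∑ i, D.e i i v = 0 := sum_operatorSystem_e v
      rw [Finset.sum_congr rfl fun i _ => D.mem_weightSpace.mp (D.mem_highest.mp hv).1 i,
        ← Finset.sum_smul] at h1
      exact (smul_eq_zero.mp h1).resolve_right hv0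
    have h1 : ∑ i, (χ i - ψ i) = 0 := by
      rw [Finset.sum_sub_distrib, hs hv.ne_zero hχ, hs hw.ne_zero hψ, sub_zero]
    rw [Finset.sum_congr rfl fun i _ => hd i, Finset.sum_const, Finset.card_univ,
      Fintype.card_fin, smul_eq_zero] at h1
    funext i
    exact sub_eq_zero.mp ((hd i).trans (h1.resolve_left (Nat.succ_ne_zero n)))
  subst hχψ
  refine D.eq_zero_of_mem_generated_prod hχ hψ (hvgen.mem_generated w) ?_
  have := act_mem_of_isStable (D.prod.isStable_generated (v, w)) u
    (D.prod.mem_generated_self (v, w))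
  rwa [show act u (v, w).1 = 0 from hu] at this

end Module

/-! ### Invariants depend only on the weight and the annihilator -/

section Transfer

variable {n : ℕ} {V : Type*} [AddCommGroup V] [Module ℂ V] [LieRingModule (G n) V]
  [LieModule ℂ (G n) V] {W : Type*} [AddCommGroup W] [Module ℂ W] [LieRingModule (G n) W]
  [LieModule ℂ (G n) W]

theorem map_act (f : V →ₗ⁅ℂ, G n⁆ W) (u : U n) (x : V) : f (act u x) = act u (f x) := by
  let S : Subalgebra ℂ (U n) :=
    { carrier := {u | ∀ x, f (act u x) = act u (f x)}
      mul_mem' := fun {a b} ha hb x => by rw [act_mul, act_mul, ha, hb]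
      add_mem' := fun {a b} ha hb x => by
        have := congrArg₂ (· + ·) (ha x) (hb x)
        simpa only [act, map_add, LinearMap.add_apply] using this
      algebraMap_mem' := fun r x => by
        simp only [act, AlgHom.commutes, Module.algebraMap_end_apply, map_smul] }
  refine mem_of_forall_ι_mem (S := S) (fun g x => ?_) u x
  simp only [act, UniversalEnvelopingAlgebra.lift_ι_apply, LieModule.toEnd_apply_apply,
    LieModuleHom.map_lie]

/-- Two vectors with the same weight, obtained from `v` and `w` by the same element of the
enveloping algebra. -/
def Parallel (v : V) (w : W) (x : Weight n × V) (y : Weight n × W) : Prop :=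
  x.1 = y.1 ∧ ∃ u : U n, x.2 = act u v ∧ y.2 = act u w

theorem Parallel.phi {v : V} {w : W} {x : Weight n × V} {y : Weight n × W}
    (h : Parallel v w x y) (i : Fin (n + 1)) : Parallel v w (phi i x) (phi i y) := by
  obtain ⟨h1, u, hx, hy⟩ := h
  refine ⟨?_, phiElt x.1 i * u, ?_, ?_⟩
  · simp only [CyclicSL.phi, h1]
  · simp only [CyclicSL.phi, hx, act_mul]
  · simp only [CyclicSL.phi, hy, h1, act_mul]

theorem Parallel.iterate_phi {v : V} {w : W} {x : Weight n × V} {y : Weight n × W}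
    (h : Parallel v w x y) (i : Fin (n + 1)) (m : ℕ) :
    Parallel v w ((CyclicSL.phi i)^[m] x) ((CyclicSL.phi i)^[m] y) := by
  induction m with
  | zero => exact h
  | succ m ih =>
    rw [Function.iterate_succ_apply', Function.iterate_succ_apply']
    exact ih.phi i

theorem Parallel.iterPhi {v : V} {w : W} {x : Weight n × V} {y : Weight n × W}
    (h : Parallel v w x y) (l : ℕ) (hl : l ≤ n + 1) (k : Fin l → ℕ) :
    Parallel v w (iterPhi x l hl k) (iterPhi y l hl k) := by
  induction l with
  | zero => exact h
  | succ l ih => exact (ih (Nat.le_of_succ_le hl) (Fin.init k)).iterate_phi _ _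

theorem invariantSet_eq {v : V} {w : W} (h : ∀ u : U n, act u v = 0 ↔ act u w = 0)
    (μ : Weight n) : invariantSet μ v = invariantSet μ w := by
  have h1 : Parallel v w (μ, v) (μ, w) := ⟨rfl, 1, by simp [act], by simp [act]⟩
  have hJ : ∀ (l : Fin (n + 1)) (k : Fin l.val → ℕ), J (μ, v) l k = J (μ, w) l k := by
    intro l k
    rw [J, J]
    congr 1
    ext m
    -- One element `u` of the enveloping algebra produces the tested vector from both generators, so
    -- the two vanish together.
    obtain ⟨-, u, hv, hw⟩ := (h1.iterPhi l.val l.isLt.le k).iterate_phi l m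
    rw [Set.mem_ofPred_eq, Set.mem_ofPred_eq, hv, hw, h u]
  simp only [invariantSet, Admissible, hJ]

end Transfer

end

end CyclicSL

theorem theorem3 (n : ℕ) (hn : 1 ≤ n)
    {V : Type*} [AddCommGroup V] [Module ℂ V] [LieRingModule (CyclicSL.G n) V]
    [LieModule ℂ (CyclicSL.G n) V] [FiniteDimensional ℂ V]
    {W : Type*} [AddCommGroup W] [Module ℂ W] [LieRingModule (CyclicSL.G n) W]
    [LieModule ℂ (CyclicSL.G n) W] [FiniteDimensional ℂ W]
    (μ₀ ν₀ : CyclicSL.Weight n) (v : V) (w : W)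
    (hv : CyclicSL.IsHighestWeightVector μ₀ v) (hvgen : CyclicSL.Generates n v)
    (hw : CyclicSL.IsHighestWeightVector ν₀ w) (hwgen : CyclicSL.Generates n w)
    (hVW : Nonempty (V ≃ₗ⁅ℂ, CyclicSL.G n⁆ W)) :
    CyclicSL.invariantSet μ₀ v = CyclicSL.invariantSet ν₀ w := by
  obtain ⟨f⟩ := hVW
  have hact : ∀ u : CyclicSL.U n, f (CyclicSL.act u v) = CyclicSL.act u (f v) :=
    fun u => CyclicSL.map_act (f : V →ₗ⁅ℂ, CyclicSL.G n⁆ W) u v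
  have hlie : ∀ g : CyclicSL.G n, ⁅g, f v⁆ = f ⁅g, v⁆ := fun g =>
    (LieModuleHom.map_lie (f : V →ₗ⁅ℂ, CyclicSL.G n⁆ W) g v).symm
  have hsmul : ∀ (c : ℂ) (x : V), f (c • x) = c • f x := fun c x =>
    map_smul (f : V →ₗ⁅ℂ, CyclicSL.G n⁆ W) c x
  have hzero : f 0 = 0 := map_zero (f : V →ₗ⁅ℂ, CyclicSL.G n⁆ W)
  have hf0 : ∀ x : V, f x = 0 ↔ x = 0 := fun x =>
    ⟨fun h => f.injective (h.trans hzero.symm), fun h => h ▸ hzero⟩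
  -- From here on `f v` and `w` are compared inside `W`.
  have hfv : CyclicSL.IsHighestWeightVector μ₀ (f v) :=
    { ne_zero := fun h => hv.ne_zero ((hf0 v).mp h)
      raising := fun i j h => by rw [hlie, hv.raising i j h, hzero]
      weight := fun i => by rw [hlie, hv.weight i, hsmul] }
  have hfgen : CyclicSL.Generates n (f v) := by
    intro y
    obtain ⟨x, rfl⟩ := f.surjective y
    obtain ⟨u, rfl⟩ := hvgen x
    exact ⟨u, (hact u).symm⟩
  obtain rfl := CyclicSL.weight_eq_of_generates hn hfv hw hfgen hwgen
  refine CyclicSL.invariantSet_eq (fun u => ?_) μ₀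
  rw [← hf0, hact]
  exact ⟨CyclicSL.act_eq_zero_of_act_eq_zero hfv hw hfgen,
    CyclicSL.act_eq_zero_of_act_eq_zero hw hfv hwgen⟩
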